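/- Let $\mathcal H,\mathcal K$ be complex Hilbert spaces of finite or countably infinite dimension, $\mathcal L(\cdot)$ the bounded operators. All outcome sets are finite. \emph{Devices.} An effect is an $E\in\mathcal L(\mathcal H)$ with $0\le E\le 1$. An observable with outcome set $\Omega$ on a Hilbert space is a map $\mathsf A$ from $\Omega$ to the effects with $\sum_{x}\mathsf A(x)=1$. An operation is a normal completely positive map $\Phi:\mathcal L(\mathcal K)\to\mathcal L(\mathcal H)$ with $\Phi(1)\le 1$, and it is a channel if $\Phi(1)=1$. An instrument $\mathcal I$ with outcome set $\Omega$ assigns to each $x\in\Omega$ an operation $\mathcal I(x,\cdot)$ such that $\sum_x\mathcal I(x,\cdot)$ is a channel. Write $\mathsf A(X)=\sum_{x\in X}\mathsf A(x)$ and $\mathcal I(X,\cdot)=\sum_{x\in X}\mathcal I(x,\cdot)$. A device is an effect or observable on $\mathcal H$, or an operation, channel or instrument from $\mathcal L(\mathcal K)$ to $\mathcal L(\mathcal H)$. \emph{Parts of an instrument $\mathcal I$ with outcome set $\Omega$.} An effect $E$ is part of $\mathcal I$ if $E=\mathcal I(X,1)$ for some $X\subseteq\Omega$; an operation or channel $\Phi$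 is part of $\mathcal I$ if $\Phi=\mathcal I(X,\cdot)$ for some $X\subseteq\Omega$. An observable $\mathsf A$ (an instrument $\mathcal I'$) with outcome set $\Omega'$ is part of $\mathcal I$ if there is $f:\Omega\to\Omega'$ with $\mathsf A(X)=\mathcal I(f^{-1}(X),1)$ (resp. $\mathcal I'(X,\cdot)=\mathcal I(f^{-1}(X),\cdot)$) for all $X\subseteq\Omega'$. Two devices are \emph{compatible} if some instrument has both as parts. They are \emph{weakly compatible} if there are instruments $\mathcal I_1,\mathcal I_2$, with outcome sets $\Omega_1,\Omega_2$, such that the first device is part of $\mathcal I_1$, the second is part of $\mathcal I_2$, and $\mathcal I_1(\Omega_1,\cdot)=\mathcal I_2(\Omega_2,\cdot)$. \emph{Measurement models.} A measurement model is a quintuple $\mathfrak M=(\mathcal V_1,\mathcal V_2,\eta,U,\mathsf F)$ consisting of complex Hilbert spaces $\mathcal V_1,\mathcal V_2$, a state (positive operator of trace one) $\eta$ on $\mathcal V_1$, a unitary operator $U:\mathcal H\otimes\mathcal V_1\to\mathcal K\otimes\mathcal V_2$, and an observable $\mathsf F$ on $\mathcal V_2$ (the pointer observable) with some outcome set $\Omega$.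 For $T\in\mathcal L(\mathcal K)$ and $S\in\mathcal L(\mathcal V_2)$ put $$\mathfrak M[T,S]=\operatorname{tr}_{\mathcal V_1}\bigl[(1\otimes\eta)\,U^*(T\otimes S)\,U\bigr]\in\mathcal L(\mathcal H),$$ where $\langle\varphi,\operatorname{tr}_{\mathcal V_1}[W]\psi\rangle=\sum_i\langle\varphi\otimes b_i,W(\psi\otimes b_i)\rangle$ for every orthonormal basis $(b_i)$ of $\mathcal V_1$. An effect $E$ is part of $\mathfrak M$ if $E=\mathfrak M[1,\mathsf F(X)]$ for some $X\subseteq\Omega$; an operation $\Phi$ if for some $X\subseteq\Omega$, $\Phi(T)=\mathfrak M[T,\mathsf F(X)]$ for all $T$; a channel $\Lambda$ if $\Lambda(T)=\mathfrak M[T,1]$ for all $T$; an observable $\mathsf A$ (an instrument $\mathcal I$) with outcome set $\Omega'$ if there is $f:\Omega\to\Omega'$ with $\mathsf A(X)=\mathfrak M[1,\mathsf F(f^{-1}(X))]$ (resp. $\mathcal I(X,T)=\mathfrak M[T,\mathsf F(f^{-1}(X))]$ for all $T$) for all $X\subseteq\Omega'$. \textbf{Proposition.} Let $\mathfrak D_1,\mathfrak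 D_2$ be two devices. (a) $\mathfrak D_1$ and $\mathfrak D_2$ are compatible if and only if there is a measurement model $\mathfrak M$ such that both $\mathfrak D_1$ and $\mathfrak D_2$ are parts of $\mathfrak M$. (b) $\mathfrak D_1$ and $\mathfrak D_2$ are weakly compatible if and only if there are two measurement models $\mathfrak M_1=(\mathcal V_1,\mathcal V_2,\eta,U,\mathsf F_1)$ and $\mathfrak M_2=(\mathcal V_1,\mathcal V_2,\eta,U,\mathsf F_2)$, differing only in their pointer observables, such that $\mathfrak D_1$ is part of $\mathfrak M_1$ and $\mathfrak D_2$ is part of $\mathfrak M_2$. In both cases, when such measurement models exist, $\mathcal V_1$ and $\mathcal V_2$ can be chosen of finite or countably infinite dimension. -/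

import Mathlib

open scoped TensorProduct CStarAlgebra InnerProductSpace

universe u₁ u₂ v w

namespace QDevice

noncomputable section

/-! ### Hilbert space tensor products -/

/-- The Hilbert space tensor product: the completion of the algebraic tensor product with respect
to the inner product determined by `⟪a ⊗ b, c ⊗ d⟫ = ⟪a, c⟫ * ⟪b, d⟫`. -/
abbrev HTensor (H : Type u₁) (V : Type u₂) [NormedAddCommGroup H] [InnerProductSpace ℂ H]
    [NormedAddCommGroup V] [InnerProductSpace ℂ V] : Type (max u₁ u₂) :=
  UniformSpace.Completion (H ⊗[ℂ] V)

/-- The elementary tensor `φ ⊗ v`. -/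
def htmul {H : Type u₁} {V : Type u₂} [NormedAddCommGroup H] [InnerProductSpace ℂ H]
    [NormedAddCommGroup V] [InnerProductSpace ℂ V] (φ : H) (v : V) : HTensor H V :=
  ((φ ⊗ₜ[ℂ] v : H ⊗[ℂ] V) : UniformSpace.Completion (H ⊗[ℂ] V))

/-- The tensor product `T ⊗ S` of two bounded operators, the bounded operator on the Hilbert space
tensor product with `(T ⊗ S) (φ ⊗ v) = T φ ⊗ S v`. -/
def opTensor {H : Type u₁} {V : Type u₂} [NormedAddCommGroup H] [InnerProductSpace ℂ H]
    [NormedAddCommGroup V] [InnerProductSpace ℂ V] (T : H →L[ℂ] H) (S : V →L[ℂ] V) :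
    HTensor H V →L[ℂ] HTensor H V :=
  (TensorProduct.mapL T S).completion

/-- `IsPartialTrace W R` says that the bounded operator `R` on `H` is the partial trace over `V` of
the bounded operator `W` on `H ⊗ V`, that is, for every orthonormal basis `b` of `V`, the series
`∑ i, ⟪φ ⊗ b i, W (ψ ⊗ b i)⟫` converges to `⟪φ, R ψ⟫`, for all `φ ψ : H`. There is at most one
such `R`. -/
def IsPartialTrace {H : Type u₁} {V : Type u₂} [NormedAddCommGroup H] [InnerProductSpace ℂ H]
    [NormedAddCommGroup V] [InnerProductSpace ℂ V]
    (W : HTensor H V →L[ℂ] HTensor H V) (R : H →L[ℂ] H) : Prop :=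
  ∀ (ι : Type u₂) (b : HilbertBasis ι ℂ V) (φ ψ : H),
    HasSum (fun i => ⟪htmul φ (b i), W (htmul ψ (b i))⟫_ℂ) ⟪φ, R ψ⟫_ℂ

/-! ### Quantum devices -/

/-- A state: a positive operator of trace one. -/
structure State (V : Type v) [NormedAddCommGroup V] [InnerProductSpace ℂ V] [CompleteSpace V] where
  op : V →L[ℂ] V
  nonneg : 0 ≤ op
  trace_eq_one : ∀ (ι : Type v) (b : HilbertBasis ι ℂ V), HasSum (fun i => ⟪b i, op (b i)⟫_ℂ) 1

/-- An effect: a bounded operator `E` with `0 ≤ E ≤ 1`. -/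
def IsEffect {H : Type u₁} [NormedAddCommGroup H] [InnerProductSpace ℂ H] [CompleteSpace H]
    (E : H →L[ℂ] H) : Prop :=
  0 ≤ E ∧ E ≤ 1

/-- An observable with the finite outcome set `Ω`. -/
structure Observable (Ω : Type w) [Fintype Ω] (H : Type u₁) [NormedAddCommGroup H]
    [InnerProductSpace ℂ H] [CompleteSpace H] where
  toFun : Ω → H →L[ℂ] H
  isEffect : ∀ x, IsEffect (toFun x)
  sum_eq_one : ∑ x, toFun x = 1

/-- `A(X) = ∑ x ∈ X, A(x)`. -/
def Observable.onSet {Ω : Type w} [Fintype Ω] {H : Type u₁} [NormedAddCommGroup H]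
    [InnerProductSpace ℂ H] [CompleteSpace H] (A : Observable Ω H) (X : Finset Ω) : H →L[ℂ] H :=
  ∑ x ∈ X, A.toFun x

section TwoSpaces

variable {H : Type u₁} {K : Type u₂}
  [NormedAddCommGroup H] [InnerProductSpace ℂ H] [CompleteSpace H]
  [NormedAddCommGroup K] [InnerProductSpace ℂ K] [CompleteSpace K]

/-- An operation (Heisenberg picture): a normal completely positive map `Φ` from the bounded
operators on `K` to those on `H` with `Φ(1) ≤ 1`. Normality is preservation of suprema of
(bounded) directed families of operators. -/
def IsOperation (Φ : (K →L[ℂ] K) →ₗ[ℂ] (H →L[ℂ] H)) : Prop :=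
  (∃ φ : (K →L[ℂ] K) →CP (H →L[ℂ] H), φ.toLinearMap = Φ) ∧ ScottContinuous Φ ∧ Φ 1 ≤ 1

/-- A channel: an operation with `Λ(1) = 1`. -/
def IsChannel (Λ : (K →L[ℂ] K) →ₗ[ℂ] (H →L[ℂ] H)) : Prop :=
  IsOperation Λ ∧ Λ 1 = 1

variable (H K) in
/-- An instrument (Heisenberg picture) with the finite outcome set `Ω`. -/
structure Instrument (Ω : Type w) [Fintype Ω] where
  toFun : Ω → (K →L[ℂ] K) →ₗ[ℂ] (H →L[ℂ] H)
  isOperation : ∀ x, IsOperation (toFun x)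
  isChannel : IsChannel (∑ x, toFun x)

/-- `I(X, ·) = ∑ x ∈ X, I(x, ·)`. -/
def Instrument.onSet {Ω : Type w} [Fintype Ω] (I : Instrument H K Ω) (X : Finset Ω) :
    (K →L[ℂ] K) →ₗ[ℂ] (H →L[ℂ] H) :=
  ∑ x ∈ X, I.toFun x

variable (H K) in
/-- A quantum device with input space `H` and (if it has a quantum output) output space `K`. -/
inductive Device : Type (max u₁ u₂ (w + 1))
  | effect (E : H →L[ℂ] H) (hE : IsEffect E)
  | observable (Ω : Type w) (_ : Fintype Ω) (A : Observable Ω H)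
  | operation (Φ : (K →L[ℂ] K) →ₗ[ℂ] (H →L[ℂ] H)) (hΦ : IsOperation Φ)
  | channel (Λ : (K →L[ℂ] K) →ₗ[ℂ] (H →L[ℂ] H)) (hΛ : IsChannel Λ)
  | instrument (Ω : Type w) (_ : Fintype Ω) (I : Instrument H K Ω)

/-! ### Compatibility in terms of instruments -/

open Classical in
/-- The preimage `f⁻¹(X)` of a subset of a finite set. -/
def preim {Ω Ω' : Type w} [Fintype Ω] (f : Ω → Ω') (X : Finset Ω') : Finset Ω :=
  Finset.univ.filter fun x => f x ∈ X

/-- The device `D` is part of the instrument `I`. -/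
def Device.IsPartOfInstrument {Ω : Type w} [Fintype Ω] (I : Instrument H K Ω) :
    Device.{u₁, u₂, w} H K → Prop
  | .effect E _ => ∃ X : Finset Ω, E = I.onSet X 1
  | .observable Ω' _ A => ∃ f : Ω → Ω', ∀ X : Finset Ω', A.onSet X = I.onSet (preim f X) 1
  | .operation Φ _ => ∃ X : Finset Ω, Φ = I.onSet X
  | .channel Λ _ => ∃ X : Finset Ω, Λ = I.onSet X
  | .instrument Ω' _ I' => ∃ f : Ω → Ω', ∀ X : Finset Ω', I'.onSet X = I.onSet (preim f X)

/-- Two devices are compatible if they are parts of one instrument. -/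
def Compatible (D₁ D₂ : Device.{u₁, u₂, w} H K) : Prop :=
  ∃ (Ω : Type w) (_ : Fintype Ω) (I : Instrument H K Ω),
    D₁.IsPartOfInstrument I ∧ D₂.IsPartOfInstrument I

/-- Two devices are weakly compatible if they are parts of two instruments having the same total
channel. -/
def WeaklyCompatible (D₁ D₂ : Device.{u₁, u₂, w} H K) : Prop :=
  ∃ (Ω₁ Ω₂ : Type w) (_ : Fintype Ω₁) (_ : Fintype Ω₂)
    (I₁ : Instrument H K Ω₁) (I₂ : Instrument H K Ω₂),
    D₁.IsPartOfInstrument I₁ ∧ D₂.IsPartOfInstrument I₂ ∧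
      I₁.onSet Finset.univ = I₂.onSet Finset.univ

/-! ### Measurement models -/

variable (H K) in
/-- The part `(V₁, V₂, η, U)` of a measurement model: ancillary Hilbert spaces, a state `η` of `V₁`
and a unitary operator `U : H ⊗ V₁ → K ⊗ V₂`. -/
structure Coupling where
  V₁ : Type v
  V₂ : Type v
  [normed₁ : NormedAddCommGroup V₁]
  [inner₁ : InnerProductSpace ℂ V₁]
  [complete₁ : CompleteSpace V₁]
  [normed₂ : NormedAddCommGroup V₂]
  [inner₂ : InnerProductSpace ℂ V₂]
  [complete₂ : CompleteSpace V₂]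
  η : State V₁
  U : HTensor H V₁ ≃ₗᵢ[ℂ] HTensor K V₂

attribute [instance] Coupling.normed₁ Coupling.inner₁ Coupling.complete₁
  Coupling.normed₂ Coupling.inner₂ Coupling.complete₂

/-- The bounded operator `(1 ⊗ η) U* (T ⊗ S) U` on `H ⊗ V₁`. -/
def Coupling.evolve (C : Coupling.{u₁, u₂, v} H K) (T : K →L[ℂ] K) (S : C.V₂ →L[ℂ] C.V₂) :
    HTensor H C.V₁ →L[ℂ] HTensor H C.V₁ :=
  let U : HTensor H C.V₁ →L[ℂ] HTensor K C.V₂ := C.U.toContinuousLinearEquiv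
  opTensor 1 C.η.op ∘L U.adjoint ∘L opTensor T S ∘L U

variable (H K) in
/-- A measurement model `(V₁, V₂, η, U, F)`, where the pointer observable `F` is an observable on
`V₂` with a finite outcome set `Ω`. -/
structure MeasurementModel extends Coupling.{u₁, u₂, v} H K where
  Ω : Type w
  [fintypeΩ : Fintype Ω]
  F : Observable Ω V₂

attribute [instance] MeasurementModel.fintypeΩ

/-- Two measurement models differ (at most) in their pointer observables. -/
def MeasurementModel.DifferOnlyInPointer (M₁ M₂ : MeasurementModel.{u₁, u₂, v, w} H K) : Prop :=
  M₁.toCoupling = M₂.toCoupling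

/-- Both ancillary spaces are separable, i.e. of finite or countably infinite dimension. -/
def MeasurementModel.IsSeparable (M : MeasurementModel.{u₁, u₂, v, w} H K) : Prop :=
  TopologicalSpace.SeparableSpace M.V₁ ∧ TopologicalSpace.SeparableSpace M.V₂

/-- The device `D` is part of the measurement model `M`. -/
def Device.IsPartOfModel (M : MeasurementModel.{u₁, u₂, v, w} H K) :
    Device.{u₁, u₂, w} H K → Prop
  | .effect E _ => ∃ X : Finset M.Ω, IsPartialTrace (M.evolve 1 (M.F.onSet X)) E
  | .observable Ω' _ A => ∃ f : M.Ω → Ω', ∀ X : Finset Ω',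
      IsPartialTrace (M.evolve 1 (M.F.onSet (preim f X))) (A.onSet X)
  | .operation Φ _ => ∃ X : Finset M.Ω, ∀ T : K →L[ℂ] K,
      IsPartialTrace (M.evolve T (M.F.onSet X)) (Φ T)
  | .channel Λ _ => ∀ T : K →L[ℂ] K, IsPartialTrace (M.evolve T 1) (Λ T)
  | .instrument Ω' _ I => ∃ f : M.Ω → Ω', ∀ (X : Finset Ω') (T : K →L[ℂ] K),
      IsPartialTrace (M.evolve T (M.F.onSet (preim f X))) (I.onSet X T)

end TwoSpaces

end

end QDevice

namespace QDevice

noncomputable section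

/-! ### Calculus of Hilbert space tensor products. -/

section HTensorBasics

variable {H : Type u₁} {V : Type u₂} [NormedAddCommGroup H] [InnerProductSpace ℂ H]
  [NormedAddCommGroup V] [InnerProductSpace ℂ V]

/-! From models to instruments: diagonalize the ancilla state as `η = ∑ |g k⟩⟨g k|` and put `G k = U
(· ⊗ g k)`. The partial trace is then the Kraus-type sum `∑ G k* (T ⊗ S) G k`, with `∑ ‖G k‖²`
finite. Such a sum is completely positive and normal (`isOperation_of_hasSum_inner_opTensor`), so
the values `F ω` of the pointer observable yield an instrument, whose total channel (`S = 1`)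
depends only on the coupling. A model and its instrument have the same parts
(`Device.isPartOfModel_iff`). The delicate case is that of channels: an instrument allows any
outcome set `X`, but `I(X, 1) = 1` forces the remaining operations to vanish.

From instruments to models: one coupling, built from the total channel `Λ` alone, realizes every
instrument with that total channel (`IsChannel.exists_coupling`). This serves (a) and (b) at once.
For a Hilbert basis `b` of `K`, the Choi kernel `(i, j) ↦ Λ (|b i⟩⟨b j|)` is positive semidefinite,
and its reproducing kernel Hilbert space carries a Stinespring dilation `x ↦ ∑ b i ⊗ k_i x`. The
kernels of the operations `I(ω, ·)` sum to that of `Λ`, so a Radon–Nikodym argument represents them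
by positive operators on this space that sum to `1` (`exists_decomposition_of_sum_eq`); these form
the pointer observable. Normal maps are determined by matrix units (`IsOperation.ext_rankOne`), so
the kernels lose no information.

To obtain a unitary, embed the kernel space into a separable infinite-dimensional `V` so as to leave
infinitely many free directions. Then `x ⊗ f 0 ↦ G x` is an isometry between subspaces with
infinite-dimensional complements and extends to `H ⊗ V → K ⊗ V`. Separability of `V` gives the
dimension claim. The case `H = 0` is treated apart. -/

@[simp]
lemma inner_htmul_htmul (a c : H) (b d : V) :
    ⟪htmul a b, htmul c d⟫_ℂ = ⟪a, c⟫_ℂ * ⟪b, d⟫_ℂ := by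
  simp [htmul]

@[simp]
lemma norm_htmul (a : H) (b : V) : ‖htmul a b‖ = ‖a‖ * ‖b‖ := by
  simp [htmul]

/-- The bounded bilinear map `(φ, v) ↦ φ ⊗ v`. -/
def htmulL (H : Type u₁) (V : Type u₂) [NormedAddCommGroup H] [InnerProductSpace ℂ H]
    [NormedAddCommGroup V] [InnerProductSpace ℂ V] : H →L[ℂ] V →L[ℂ] HTensor H V :=
  (ContinuousLinearMap.compL ℂ V (H ⊗[ℂ] V) (HTensor H V)
    (UniformSpace.Completion.toComplL (𝕜 := ℂ) (E := H ⊗[ℂ] V))) ∘L TensorProduct.mkL ℂ H V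

@[simp]
lemma htmulL_apply (a : H) (b : V) : htmulL H V a b = htmul a b := rfl

/-- The bounded operator `φ ↦ φ ⊗ v`. -/
def htmulRight (v : V) : H →L[ℂ] HTensor H V := (htmulL H V).flip v

@[simp]
lemma htmulRight_apply (v : V) (a : H) : htmulRight v a = htmul a v := rfl

@[simp]
lemma opTensor_htmul (T : H →L[ℂ] H) (S : V →L[ℂ] V) (a : H) (b : V) :
    opTensor T S (htmul a b) = htmul (T a) (S b) := by
  simp only [opTensor, htmul]
  rw [ContinuousLinearMap.completion_apply_coe, TensorProduct.mapL_tmul]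

/-- The elementary tensors. -/
def elementaryTensors (H : Type u₁) (V : Type u₂) [NormedAddCommGroup H] [InnerProductSpace ℂ H]
    [NormedAddCommGroup V] [InnerProductSpace ℂ V] : Set (HTensor H V) :=
  {x | ∃ a b, x = htmul a b}

lemma dense_span_elementaryTensors :
    Dense (Submodule.span ℂ (elementaryTensors H V) : Set (HTensor H V)) := by
  have h : Set.range ((↑) : H ⊗[ℂ] V → HTensor H V) ⊆
      Submodule.span ℂ (elementaryTensors H V) := by
    rintro _ ⟨x, rfl⟩
    induction x using TensorProduct.induction_on with
    | zero => rw [UniformSpace.Completion.coe_zero]; exact Submodule.zero_mem _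
    | tmul a b => exact Submodule.subset_span ⟨a, b, rfl⟩
    | add x y hx hy =>
      rw [UniformSpace.Completion.coe_add]
      exact Submodule.add_mem _ hx hy
  exact UniformSpace.Completion.denseRange_coe.mono h

lemma clm_ext_htmul {F : Type*} [NormedAddCommGroup F] [NormedSpace ℂ F]
    {A B : HTensor H V →L[ℂ] F} (h : ∀ a b, A (htmul a b) = B (htmul a b)) : A = B := by
  refine ContinuousLinearMap.ext_on dense_span_elementaryTensors ?_
  rintro _ ⟨a, b, rfl⟩
  exact h a b

lemma hTensor_ext_inner {x y : HTensor H V}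
    (h : ∀ a b, ⟪x, htmul a b⟫_ℂ = ⟪y, htmul a b⟫_ℂ) : x = y := by
  refine ext_inner_right ℂ fun z => ?_
  exact DFunLike.congr_fun (clm_ext_htmul (A := innerSL ℂ x) (B := innerSL ℂ y) h) z

lemma htmul_add_left (a a' : H) (b : V) : htmul (a + a') b = htmul a b + htmul a' b :=
  map_add (htmulRight b) a a'

lemma htmul_smul_left (c : ℂ) (a : H) (b : V) : htmul (c • a) b = c • htmul a b :=
  map_smul (htmulRight b) c a

lemma htmul_sum_right {ι : Type*} (s : Finset ι) (a : H) (b : ι → V) :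
    htmul a (∑ i ∈ s, b i) = ∑ i ∈ s, htmul a (b i) :=
  map_sum (htmulL H V a) b s

lemma opTensor_add_left (T T' : H →L[ℂ] H) (S : V →L[ℂ] V) :
    opTensor (T + T') S = opTensor T S + opTensor T' S :=
  clm_ext_htmul fun a b => by simp [htmul_add_left]

lemma opTensor_smul_left (c : ℂ) (T : H →L[ℂ] H) (S : V →L[ℂ] V) :
    opTensor (c • T) S = c • opTensor T S :=
  clm_ext_htmul fun a b => by simp [htmul_smul_left]

lemma opTensor_sum_right {ι : Type*} (s : Finset ι) (T : H →L[ℂ] H) (S : ι → V →L[ℂ] V) :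
    opTensor T (∑ i ∈ s, S i) = ∑ i ∈ s, opTensor T (S i) :=
  clm_ext_htmul fun a b => by simp [htmul_sum_right]

@[simp]
lemma opTensor_one_one : opTensor (1 : H →L[ℂ] H) (1 : V →L[ℂ] V) = 1 :=
  clm_ext_htmul fun a b => by simp

lemma opTensor_mul (T T' : H →L[ℂ] H) (S S' : V →L[ℂ] V) :
    opTensor (T * T') (S * S') = opTensor T S * opTensor T' S' :=
  clm_ext_htmul fun a b => by simp

lemma norm_opTensor_le (T : H →L[ℂ] H) (S : V →L[ℂ] V) : ‖opTensor T S‖ ≤ ‖T‖ * ‖S‖ := by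
  refine ContinuousLinearMap.opNorm_le_bound _ (by positivity) fun x => ?_
  induction x using UniformSpace.Completion.induction_on with
  | hp => exact isClosed_le (by fun_prop) (by fun_prop)
  | ih x =>
    rw [opTensor, ContinuousLinearMap.completion_apply_coe, UniformSpace.Completion.norm_coe,
      UniformSpace.Completion.norm_coe]
    exact (ContinuousLinearMap.le_opNorm _ _).trans
      (mul_le_mul_of_nonneg_right (TensorProduct.norm_mapL_le T S) (norm_nonneg _))

lemma adjoint_opTensor [CompleteSpace H] [CompleteSpace V] (T : H →L[ℂ] H) (S : V →L[ℂ] V) :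
    (opTensor T S).adjoint = opTensor T.adjoint S.adjoint := by
  refine clm_ext_htmul fun a b => hTensor_ext_inner fun c d => ?_
  simp [ContinuousLinearMap.adjoint_inner_left]

lemma separableSpace_hTensor [TopologicalSpace.SeparableSpace H]
    [TopologicalSpace.SeparableSpace V] : TopologicalSpace.SeparableSpace (HTensor H V) := by
  have h : elementaryTensors H V ⊆ Set.range fun p : H × V => htmulL H V p.1 p.2 := by
    rintro _ ⟨a, b, rfl⟩
    exact ⟨(a, b), rfl⟩
  have hs : TopologicalSpace.IsSeparable (elementaryTensors H V) :=
    (TopologicalSpace.isSeparable_range (by fun_prop)).mono h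
  have := hs.span (R := ℂ).closure
  rw [dense_span_elementaryTensors.closure_eq] at this
  exact TopologicalSpace.isSeparable_univ_iff.1 this

end HTensorBasics

open Filter Topology

/-! ### Weak limits of monotone nets of operators. -/

section MonotoneNets

variable {H : Type*} [NormedAddCommGroup H] [InnerProductSpace ℂ H]

lemma nonneg_iff_inner {A : H →L[ℂ] H} :
    0 ≤ A ↔ ∀ x, (0 : ℝ) ≤ (⟪x, A x⟫_ℂ).re ∧ (⟪x, A x⟫_ℂ).im = 0 := by
  rw [ContinuousLinearMap.nonneg_iff_isPositive, ContinuousLinearMap.isPositive_iff_complex]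
  refine forall_congr' fun x => ?_
  have hre : (⟪A x, x⟫_ℂ).re = (⟪x, A x⟫_ℂ).re := inner_re_symm (𝕜 := ℂ) _ _
  have him : (⟪A x, x⟫_ℂ).im = -(⟪x, A x⟫_ℂ).im := inner_im_symm (𝕜 := ℂ) _ _
  rw [Complex.ext_iff]
  simp [hre, him, and_comm, eq_comm]

lemma re_inner_le_of_le [CompleteSpace H] {A B : H →L[ℂ] H} (h : A ≤ B) (x : H) :
    (⟪x, A x⟫_ℂ).re ≤ (⟪x, B x⟫_ℂ).re := by
  have := ((nonneg_iff_inner.1 (sub_nonneg.2 h)) x).1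
  simpa [inner_sub_right] using this

variable [CompleteSpace H] {α : Type*} [Preorder α] [IsDirectedOrder α] [Nonempty α]

/-- A decreasing net of positive operators has a weak limit, a positive operator below the net. -/
lemma exists_tendsto_inner_of_antitone (D : α → H →L[ℂ] H) (hD : Antitone D) (h0 : ∀ a, 0 ≤ D a) :
    ∃ B : H →L[ℂ] H, 0 ≤ B ∧ (∀ a, B ≤ D a) ∧
      ∀ x y, Tendsto (fun a => ⟪D a x, y⟫_ℂ) atTop (𝓝 ⟪B x, y⟫_ℂ) := by
  obtain ⟨a₀⟩ := ‹Nonempty α›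
  have : Nonempty α := ⟨a₀⟩
  have hM : ∀ᶠ a in atTop, ‖D a‖ ≤ ‖D a₀‖ := by
    filter_upwards [eventually_ge_atTop a₀] with a ha
    exact CStarAlgebra.norm_le_norm_of_nonneg_of_le (h0 a) (hD ha)
  have hq : ∀ x, ∃ l : ℂ, Tendsto (fun a => ⟪D a x, x⟫_ℂ) atTop (𝓝 l) := by
    intro x
    have hanti : Antitone fun a => (⟪x, D a x⟫_ℂ).re := fun a b hab => re_inner_le_of_le (hD hab) x
    have hbdd : BddBelow (Set.range fun a => (⟪x, D a x⟫_ℂ).re) := by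
      refine ⟨0, ?_⟩
      rintro _ ⟨a, rfl⟩
      exact (nonneg_iff_inner.1 (h0 a) x).1
    have ht := tendsto_atTop_ciInf hanti hbdd
    refine ⟨_, ((Complex.continuous_ofReal.tendsto _).comp ht).congr fun a => ?_⟩
    have hre : (⟪D a x, x⟫_ℂ).re = (⟪x, D a x⟫_ℂ).re := inner_re_symm (𝕜 := ℂ) _ _
    have him : (⟪D a x, x⟫_ℂ).im = -(⟪x, D a x⟫_ℂ).im := inner_im_symm (𝕜 := ℂ) _ _
    have := (nonneg_iff_inner.1 (h0 a) x).2
    apply Complex.ext <;> simp [this, hre, him]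
  -- Polarization passes from the convergent quadratic forms to all matrix elements; the limits form
  -- a bounded sesquilinear form, which Riesz represents by `B`.
  have hl : ∀ x y, ∃ l : ℂ, Tendsto (fun a => ⟪D a x, y⟫_ℂ) atTop (𝓝 l) := by
    intro x y
    obtain ⟨l1, h1⟩ := hq (x + y)
    obtain ⟨l2, h2⟩ := hq (x - y)
    obtain ⟨l3, h3⟩ := hq (x + Complex.I • y)
    obtain ⟨l4, h4⟩ := hq (x - Complex.I • y)
    refine ⟨_, ((((h1.sub h2).sub (h3.const_mul Complex.I)).add
      (h4.const_mul Complex.I)).div_const 4).congr fun a => ?_⟩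
    exact (inner_map_polarization' (D a : H →ₗ[ℂ] H) x y).symm
  choose l hl using hl
  let S : H →ₗ⋆[ℂ] H →ₗ[ℂ] ℂ := LinearMap.mk₂'ₛₗ (starRingEnd ℂ) (RingHom.id ℂ) l
    (fun x y z => tendsto_nhds_unique (hl _ _) (((hl x z).add (hl y z)).congr fun a => by
      rw [map_add, inner_add_left]))
    (fun c x z => tendsto_nhds_unique (hl _ _) (((hl x z).const_mul _).congr fun a => by
      rw [map_smul, inner_smul_left]))
    (fun x y z => tendsto_nhds_unique (hl _ _) (((hl x y).add (hl x z)).congr fun a => by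
      rw [inner_add_right]))
    (fun c x z => tendsto_nhds_unique (hl _ _) (((hl x z).const_mul _).congr fun a => by
      rw [inner_smul_right]; rfl))
  have hS : ∀ x y, ‖S x y‖ ≤ ‖D a₀‖ * ‖x‖ * ‖y‖ := fun x y => by
    refine le_of_tendsto (hl x y).norm ?_
    filter_upwards [hM] with a ha
    calc ‖⟪D a x, y⟫_ℂ‖ ≤ ‖D a x‖ * ‖y‖ := norm_inner_le_norm _ _
      _ ≤ ‖D a₀‖ * ‖x‖ * ‖y‖ := by
        gcongr
        exact ((D a).le_opNorm x).trans (by gcongr)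
  let B := InnerProductSpace.continuousLinearMapOfBilin (S.mkContinuous₂ _ hS)
  have hB : ∀ x y, ⟪B x, y⟫_ℂ = l x y := fun x y => by
    simp only [B, InnerProductSpace.continuousLinearMapOfBilin_apply]
    rfl
  have htend : ∀ x y, Tendsto (fun a => ⟪D a x, y⟫_ℂ) atTop (𝓝 ⟪B x, y⟫_ℂ) := fun x y => by
    rw [hB]; exact hl x y
  have htend' : ∀ x, Tendsto (fun a => ⟪x, D a x⟫_ℂ) atTop (𝓝 ⟪x, B x⟫_ℂ) := fun x => by
    have := (Complex.continuous_conj.tendsto _).comp (htend x x)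
    rw [inner_conj_symm] at this
    exact this.congr fun a => inner_conj_symm _ _
  refine ⟨B, ?_, fun a => ?_, htend⟩
  · refine nonneg_iff_inner.2 fun x => ⟨?_, ?_⟩
    · exact ge_of_tendsto' ((Complex.continuous_re.tendsto _).comp (htend' x))
        fun a => (nonneg_iff_inner.1 (h0 a) x).1
    · refine tendsto_nhds_unique ((Complex.continuous_im.tendsto _).comp (htend' x)) ?_
      exact tendsto_const_nhds.congr fun a => ((nonneg_iff_inner.1 (h0 a) x).2).symm
  · rw [← sub_nonneg]
    refine nonneg_iff_inner.2 fun x => ?_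
    have ht : Tendsto (fun b => ⟪x, (D a - D b) x⟫_ℂ) atTop (𝓝 ⟪x, (D a - B) x⟫_ℂ) := by
      simp only [sub_apply, inner_sub_right]
      exact tendsto_const_nhds.sub (htend' x)
    have hpos : ∀ᶠ b in atTop, 0 ≤ D a - D b := by
      filter_upwards [eventually_ge_atTop a] with b hb
      exact sub_nonneg.2 (hD hb)
    constructor
    · refine ge_of_tendsto ((Complex.continuous_re.tendsto _).comp ht) ?_
      filter_upwards [hpos] with b hb
      exact (nonneg_iff_inner.1 hb x).1
    · refine tendsto_nhds_unique ((Complex.continuous_im.tendsto _).comp ht) ?_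
      refine tendsto_const_nhds.congr' ?_
      filter_upwards [hpos] with b hb
      exact ((nonneg_iff_inner.1 hb x).2).symm

/-- An increasing net of operators with a supremum converges weakly to the supremum. -/
lemma tendsto_inner_of_isLUB (f : α → H →L[ℂ] H) (hf : Monotone f) {T : H →L[ℂ] H}
    (hT : IsLUB (Set.range f) T) (x y : H) :
    Tendsto (fun a => ⟪x, f a y⟫_ℂ) atTop (𝓝 ⟪x, T y⟫_ℂ) := by
  obtain ⟨B, hB0, hBD, hB⟩ := exists_tendsto_inner_of_antitone (fun a => T - f a)
    (fun a b hab => sub_le_sub_left (hf hab) T)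
    (fun a => sub_nonneg.2 (hT.1 ⟨a, rfl⟩))
  -- The weak limit `B` lies below every `T - f a`, so `T - B` is still an upper bound; minimality
  -- of `T` forces `B = 0`.
  have hle : T ≤ T - B := hT.2 (by
    rintro _ ⟨a, rfl⟩
    exact le_sub_comm.1 (hBD a))
  have hB' : B = 0 := le_antisymm (by simpa using hle) hB0
  have h := (Complex.continuous_conj.tendsto _).comp (hB y x)
  simp only [hB', zero_apply, inner_zero_left, map_zero, Function.comp_def,
    inner_conj_symm, sub_apply, inner_sub_right] at h
  simpa using (tendsto_const_nhds (x := ⟪x, T y⟫_ℂ)).sub h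

end MonotoneNets

/-! ### Testing convergence of bounded nets on dense subspaces. -/

section DenseConvergence

lemma tendsto_apply_of_dense_span {α E F : Type*} [NormedAddCommGroup E] [NormedSpace ℂ E]
    [NormedAddCommGroup F] [NormedSpace ℂ F] {l : Filter α} {A : α → E →L[ℂ] F} {A₀ : E →L[ℂ] F}
    {M : ℝ} (hM : ∀ᶠ a in l, ‖A a‖ ≤ M) {s : Set E}
    (hs : Dense (Submodule.span ℂ s : Set E))
    (h : ∀ x ∈ s, Tendsto (fun a => A a x) l (𝓝 (A₀ x))) (x : E) :
    Tendsto (fun a => A a x) l (𝓝 (A₀ x)) := by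
  have hspan : ∀ y ∈ Submodule.span ℂ s, Tendsto (fun a => A a y) l (𝓝 (A₀ y)) := by
    intro y hy
    induction hy using Submodule.span_induction with
    | mem y hy => exact h y hy
    | zero => simp [tendsto_const_nhds]
    | add y z _ _ hy hz => simpa using hy.add hz
    | smul c y _ hy => simpa using hy.const_smul c
  rw [Metric.tendsto_nhds]
  intro ε hε
  -- The absolute value is needed because no sign is known for `M` (the filter may be trivial); the
  -- summand `1` makes `C` positive.
  set C := |M| + ‖A₀‖ + 1 with hC
  have hCpos : 0 < C := by positivity
  obtain ⟨y, hy, hxy⟩ := Metric.dense_iff.1 hs x (ε / (2 * C)) (by positivity)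
  have hyx : ‖x - y‖ < ε / (2 * C) := by
    rw [Metric.mem_ball, dist_comm, dist_eq_norm] at hy; exact hy
  filter_upwards [hM, Metric.tendsto_nhds.1 (hspan y hxy) (ε / 2) (by positivity)] with a ha hay
  rw [dist_eq_norm] at hay ⊢
  calc ‖A a x - A₀ x‖ = ‖(A a (x - y) - A₀ (x - y)) + (A a y - A₀ y)‖ := by
        simp only [map_sub]; congr 1; abel
    _ ≤ ‖A a (x - y)‖ + ‖A₀ (x - y)‖ + ‖A a y - A₀ y‖ :=
        (norm_add_le _ _).trans (by gcongr; exact norm_sub_le _ _)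
    _ ≤ M * ‖x - y‖ + ‖A₀‖ * ‖x - y‖ + ‖A a y - A₀ y‖ := by
        gcongr
        · exact ((A a).le_opNorm _).trans (by gcongr)
        · exact A₀.le_opNorm _
    _ ≤ C * ‖x - y‖ + ‖A a y - A₀ y‖ := by
        have := le_abs_self M
        have h0 := norm_nonneg (x - y)
        nlinarith
    _ < C * (ε / (2 * C)) + ε / 2 := by gcongr
    _ = ε := by field_simp; ring

/-- Weak convergence of a bounded net of operators can be tested on a set with dense span. -/
lemma tendsto_inner_of_dense_span {α E : Type*} [NormedAddCommGroup E] [InnerProductSpace ℂ E]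
    {l : Filter α} {A : α → E →L[ℂ] E} {A₀ : E →L[ℂ] E}
    {M : ℝ} (hM : ∀ᶠ a in l, ‖A a‖ ≤ M) {s : Set E}
    (hs : Dense (Submodule.span ℂ s : Set E))
    (h : ∀ x ∈ s, ∀ y ∈ s, Tendsto (fun a => ⟪x, A a y⟫_ℂ) l (𝓝 ⟪x, A₀ y⟫_ℂ)) (x y : E) :
    Tendsto (fun a => ⟪x, A a y⟫_ℂ) l (𝓝 ⟪x, A₀ y⟫_ℂ) := by
  have h1 : ∀ x ∈ s, ∀ y, Tendsto (fun a => ⟪x, A a y⟫_ℂ) l (𝓝 ⟪x, A₀ y⟫_ℂ) := fun x hx y =>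
    tendsto_apply_of_dense_span (A := fun a => innerSL ℂ x ∘L A a) (A₀ := innerSL ℂ x ∘L A₀)
      (M := ‖x‖ * M)
      (hM.mono fun a ha => (ContinuousLinearMap.opNorm_comp_le _ _).trans (by
        rw [innerSL_apply_norm]; gcongr)) hs (fun z hz => h x hx z hz) y
  -- The second pass frees the other argument; conjugation makes the form linear in it.
  have h2 := tendsto_apply_of_dense_span (A := fun a => innerSL ℂ (A a y))
    (A₀ := innerSL ℂ (A₀ y)) (M := M * ‖y‖) (l := l)
    (hM.mono fun a ha => by
      rw [innerSL_apply_norm]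
      exact ((A a).le_opNorm y).trans (by gcongr)) hs (fun z hz => by
        have := (Complex.continuous_conj.tendsto _).comp (h1 z hz y)
        simpa [Function.comp_def, inner_conj_symm] using this) x
  have h3 := (Complex.continuous_conj.tendsto _).comp h2
  simpa [Function.comp_def, inner_conj_symm] using h3

end DenseConvergence

/-! ### Positivity of matrices over a C⋆-algebra via quadratic forms. -/

section CStarMatrixPositivity

lemma exists_eq_star_mul_self_of_nonneg {B : Type*} [NonUnitalCStarAlgebra B] [PartialOrder B]
    [StarOrderedRing B] {a : B} (h : 0 ≤ a) : ∃ b, a = star b * b :=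
  CStarAlgebra.nonneg_iff_eq_star_mul_self.1 h

lemma exists_jordan_decomposition {B : Type*} [NonUnitalCStarAlgebra B] [PartialOrder B]
    [StarOrderedRing B] {a : B} (h : IsSelfAdjoint a) :
    ∃ p q : B, 0 ≤ p ∧ 0 ≤ q ∧ a = p - q ∧ q * p = 0 :=
  ⟨a⁺, a⁻, CFC.posPart_nonneg a, CFC.negPart_nonneg a, (CFC.posPart_sub_negPart a).symm,
    CFC.negPart_mul_posPart a⟩

variable {A : Type*} [CStarAlgebra A] [PartialOrder A] [StarOrderedRing A]
  {n : Type*} [Fintype n]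

lemma cstarMatrix_eq_zero_of_diag_star_mul_self {N : CStarMatrix n n A}
    (h : ∀ k, (star N * N) k k = 0) : N = 0 := by
  refine CStarMatrix.ext fun i k => ?_
  have hk := h k
  simp only [CStarMatrix.mul_apply, CStarMatrix.star_apply] at hk
  rw [Finset.sum_eq_zero_iff_of_nonneg fun j _ => star_mul_self_nonneg (N j k)] at hk
  exact (CStarRing.star_mul_self_eq_zero_iff _).1 (hk i (Finset.mem_univ i))

/-- With `P = N* N`, the form is a sum over `k` of squares of `∑ i, N k i * x i`. -/
lemma sum_star_mul_mul_nonneg_of_cstarMatrix_nonneg {P : CStarMatrix n n A} (hP : 0 ≤ P)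
    (x : n → A) : 0 ≤ ∑ i, ∑ j, star (x i) * P i j * x j := by
  obtain ⟨N, rfl⟩ := exists_eq_star_mul_self_of_nonneg hP
  have : ∑ i, ∑ j, star (x i) * (star N * N) i j * x j =
      ∑ k, star (∑ i, N k i * x i) * ∑ j, N k j * x j := by
    simp only [CStarMatrix.mul_apply, CStarMatrix.star_apply, star_sum, star_mul,
      Finset.mul_sum, Finset.sum_mul, mul_assoc]
    rw [Finset.sum_comm_cycle]
    refine Finset.sum_congr rfl fun k _ => ?_
    rw [Finset.sum_comm]
  rw [this]
  exact Finset.sum_nonneg fun k _ => star_mul_self_nonneg _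

/-- Split `P = p - q` into positive and negative parts. Since `q p = 0`, one has `q P q = -q³`.
Testing the form on the columns of `q` shows that the diagonal of the positive matrix `q³` is
nonpositive, hence `q³ = 0` and `q = 0`. -/
lemma cstarMatrix_nonneg_of_sum_star_mul_mul_nonneg {P : CStarMatrix n n A}
    (hP : IsSelfAdjoint P) (h : ∀ x : n → A, 0 ≤ ∑ i, ∑ j, star (x i) * P i j * x j) :
    0 ≤ P := by
  obtain ⟨p, q, hp, hq, rfl, hqp⟩ := exists_jordan_decomposition hP
  have hqs : star q = q := hq.isSelfAdjoint.star_eq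
  have hq3 : q * (p - q) * q = -(q * q * q) := by
    rw [mul_sub, hqp]
    simp
  have hpos : 0 ≤ q * q * q := by
    have := star_left_conjugate_nonneg hq q
    rwa [hqs] at this
  obtain ⟨N, hN⟩ := exists_eq_star_mul_self_of_nonneg hpos
  have hN0 : N = 0 := by
    refine cstarMatrix_eq_zero_of_diag_star_mul_self fun k => le_antisymm ?_ ?_
    · rw [← hN, ← neg_nonneg]
      have h1 := h fun i => q i k
      have h2 : ∑ i, ∑ j, star (q i k) * (p - q) i j * q j k = (q * (p - q) * q) k k := by
        simp only [CStarMatrix.mul_apply, Finset.sum_mul]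
        rw [Finset.sum_comm]
        refine Finset.sum_congr rfl fun i _ => Finset.sum_congr rfl fun j _ => ?_
        rw [← CStarMatrix.star_apply, hqs]
      rwa [h2, hq3] at h1
    · simp only [CStarMatrix.mul_apply, CStarMatrix.star_apply]
      exact Finset.sum_nonneg fun j _ => star_mul_self_nonneg _
  rw [hN0, star_zero, zero_mul] at hN
  have h4 : star (q * q) * (q * q) = 0 := by
    rw [star_mul, hqs, ← mul_assoc, hN, zero_mul]
  have h2 : star q * q = 0 := by
    rw [hqs]; exact (CStarRing.star_mul_self_eq_zero_iff _).1 h4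
  have h1 : q = 0 := (CStarRing.star_mul_self_eq_zero_iff _).1 h2
  rwa [h1, sub_zero]

end CStarMatrixPositivity

/-! ### Positive semidefinite kernels and Cauchy–Schwarz for operations. -/

section Kernel

variable {H : Type u₁} {K : Type u₂}
  [NormedAddCommGroup H] [InnerProductSpace ℂ H] [CompleteSpace H]
  [NormedAddCommGroup K] [InnerProductSpace ℂ K] [CompleteSpace K]

/-- The operator-valued kernel `(x, y) ↦ Φ (A x* A y)`. -/
def opKernel (Φ : (K →L[ℂ] K) →ₗ[ℂ] (H →L[ℂ] H)) {X : Type*} (A : X → K →L[ℂ] K) :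
    Matrix X X (H →L[ℂ] H) :=
  Matrix.of fun x y => Φ (star (A x) * A y)

omit [CompleteSpace H] in
@[simp]
lemma opKernel_apply (Φ : (K →L[ℂ] K) →ₗ[ℂ] (H →L[ℂ] H)) {X : Type*} (A : X → K →L[ℂ] K)
    (x y : X) : opKernel Φ A x y = Φ (star (A x) * A y) := rfl

variable {Φ : (K →L[ℂ] K) →ₗ[ℂ] (H →L[ℂ] H)}

lemma IsOperation.map_star (hΦ : IsOperation Φ) (T : K →L[ℂ] K) : Φ (star T) = star (Φ T) := by
  obtain ⟨⟨φ, rfl⟩, -, -⟩ := hΦ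
  exact StarHomClass.map_star φ T

lemma IsOperation.monotone (hΦ : IsOperation Φ) : Monotone Φ := hΦ.2.1.monotone

/-- A finite Gram matrix `(A i* A j)` is positive, so complete positivity applies to it entrywise.
-/
lemma IsOperation.posSemidef_opKernel (hΦ : IsOperation Φ) {X : Type*} (A : X → K →L[ℂ] K) :
    (opKernel Φ A).PosSemidef := by
  classical
  refine ⟨?_, fun f => ?_⟩
  · ext1 x y
    simp [← hΦ.map_star]
  · obtain ⟨φ, hφ⟩ := hΦ.1
    rcases f.support.eq_empty_or_nonempty with h0 | ⟨x₀, hx₀⟩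
    · rw [Finsupp.support_eq_empty.1 h0]; simp
    · let n := {x // x ∈ f.support}
      -- The Gram matrix is `N* N` for the square matrix whose only nonzero row, at `x₀`, lists the
      -- `A j`; this is why the support must be nonempty.
      let N : CStarMatrix n n (K →L[ℂ] K) :=
        CStarMatrix.ofMatrix fun i j => if i = ⟨x₀, hx₀⟩ then A j else 0
      have hN' : ∀ i j, N i j = if i = ⟨x₀, hx₀⟩ then A j else 0 := fun _ _ => rfl
      have hN : ∀ i j, (star N * N) i j = star (A i) * A j := by
        intro i j
        rw [CStarMatrix.mul_apply, Finset.sum_eq_single ⟨x₀, hx₀⟩]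
        · simp [CStarMatrix.star_apply, hN']
        · intro k _ hk
          simp [CStarMatrix.star_apply, hN', hk]
        · simp
      have h1 := φ.map_cstarMatrix_nonneg (star N * N) (star_mul_self_nonneg N)
      have h2 := sum_star_mul_mul_nonneg_of_cstarMatrix_nonneg h1 fun i : n => f i
      simp only [CStarMatrix.map_apply, hN] at h2
      rw [Finsupp.sum, ← Finset.sum_coe_sort]
      refine h2.trans_eq (Finset.sum_congr rfl fun i _ => ?_)
      rw [Finsupp.sum, ← Finset.sum_coe_sort f.support
        fun j => star (f i) * opKernel Φ A i j * f j]
      refine Finset.sum_congr rfl fun j _ => ?_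
      rw [opKernel_apply, ← hφ]
      rfl

open RKHS

/-- The Cauchy–Schwarz inequality for operations. -/
lemma IsOperation.norm_inner_sq_le (hΦ : IsOperation Φ) (S T : K →L[ℂ] K) (x y : H) :
    ‖⟪x, Φ (star S * T) y⟫_ℂ‖ ^ 2 ≤
      (⟪x, Φ (star S * S) x⟫_ℂ).re * (⟪y, Φ (star T * T) y⟫_ℂ).re := by
  -- Indexing the kernel by all operators turns `⟪x, Φ (S* T) y⟫` into an honest inner product of
  -- kernel vectors.
  let k := opKernel Φ (id : (K →L[ℂ] K) → K →L[ℂ] K)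
  have : Fact k.PosSemidef := ⟨hΦ.posSemidef_opKernel _⟩
  have hk : ∀ S T x y, ⟪x, Φ (star S * T) y⟫_ℂ =
      ⟪kerFun (OfKernel k) S x, kerFun (OfKernel k) T y⟫_ℂ := by
    intro S T x y
    rw [kerFun_inner, kerFun_apply, OfKernel.kernel_ofKernel]
    rfl
  have hk' : ∀ S x, (⟪x, Φ (star S * S) x⟫_ℂ).re = ‖kerFun (OfKernel k) S x‖ ^ 2 := by
    intro S x
    rw [hk]
    exact (norm_sq_eq_re_inner (𝕜 := ℂ) _).symm
  rw [hk', hk', hk, ← mul_pow]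
  gcongr
  exact norm_inner_le_norm _ _

lemma IsOperation.eq_zero_of_map_one (hΦ : IsOperation Φ) (h : Φ 1 = 0) : Φ = 0 := by
  refine LinearMap.ext fun T => ContinuousLinearMap.ext fun y => ext_inner_left ℂ fun x => ?_
  have := hΦ.norm_inner_sq_le 1 T x y
  simp only [star_one, one_mul, h, zero_apply, inner_zero_right, Complex.zero_re, zero_mul] at this
  simpa using this

end Kernel

/-! ### Complete positivity and normality of Kraus-type sums. -/

section Criterion

open scoped ComplexOrder in
lemma nonneg_iff_inner_nonneg {H : Type*} [NormedAddCommGroup H] [InnerProductSpace ℂ H]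
    {A : H →L[ℂ] H} : 0 ≤ A ↔ ∀ x, 0 ≤ ⟪x, A x⟫_ℂ := by
  rw [nonneg_iff_inner]
  refine forall_congr' fun x => ?_
  rw [Complex.nonneg_iff]
  exact and_congr_right fun _ => eq_comm

lemma opTensor_one_left_nonneg {H : Type u₁} {V : Type u₂}
    [NormedAddCommGroup H] [InnerProductSpace ℂ H] [CompleteSpace H]
    [NormedAddCommGroup V] [InnerProductSpace ℂ V] [CompleteSpace V] {S : V →L[ℂ] V}
    (hS : 0 ≤ S) : 0 ≤ opTensor (1 : H →L[ℂ] H) S := by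
  obtain ⟨s, rfl⟩ := exists_eq_star_mul_self_of_nonneg hS
  have : opTensor (1 : H →L[ℂ] H) (star s * s) = star (opTensor 1 s) * opTensor 1 s := by
    rw [ContinuousLinearMap.star_eq_adjoint (opTensor 1 s), adjoint_opTensor, ← opTensor_mul,
      ← ContinuousLinearMap.star_eq_adjoint, ← ContinuousLinearMap.star_eq_adjoint, star_one,
      one_mul]
  rw [this]
  exact star_mul_self_nonneg (opTensor (1 : H →L[ℂ] H) s)

variable {H : Type u₁} {K : Type u₂} {V : Type v}
  [NormedAddCommGroup H] [InnerProductSpace ℂ H] [CompleteSpace H]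
  [NormedAddCommGroup K] [InnerProductSpace ℂ K] [CompleteSpace K]
  [NormedAddCommGroup V] [InnerProductSpace ℂ V] [CompleteSpace V]
  {κ : Type*} {G : κ → H →L[ℂ] HTensor K V} {S : V →L[ℂ] V}
  {Φ : (K →L[ℂ] K) →ₗ[ℂ] (H →L[ℂ] H)}

lemma eventually_norm_le_of_isLUB {α : Type*} [Preorder α] [IsDirectedOrder α] [Nonempty α]
    (f : α → K →L[ℂ] K) (hf : Monotone f) {T : K →L[ℂ] K} (hT : IsLUB (Set.range f) T) :
    ∃ M, ∀ᶠ a in atTop, ‖f a‖ ≤ M := by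
  obtain ⟨a₀⟩ := ‹Nonempty α›
  refine ⟨‖T‖ + ‖T - f a₀‖, ?_⟩
  filter_upwards [eventually_ge_atTop a₀] with a ha
  have h1 : ‖T - f a‖ ≤ ‖T - f a₀‖ := CStarAlgebra.norm_le_norm_of_nonneg_of_le
    (sub_nonneg.2 (hT.1 ⟨a, rfl⟩)) (sub_le_sub_left (hf ha) T)
  calc ‖f a‖ = ‖T - (T - f a)‖ := by rw [sub_sub_cancel]
    _ ≤ _ := (norm_sub_le _ _).trans (by gcongr)

-- A tail of the increasing net is norm bounded, so weak convergence need only be checked on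
-- elementary tensors, where it factors.
omit [CompleteSpace V] in
lemma tendsto_inner_opTensor_of_isLUB {α : Type*} [Preorder α] [IsDirectedOrder α] [Nonempty α]
    (f : α → K →L[ℂ] K) (hf : Monotone f) {T : K →L[ℂ] K} (hT : IsLUB (Set.range f) T)
    (S : V →L[ℂ] V) (x y : HTensor K V) :
    Tendsto (fun a => ⟪x, opTensor (f a) S y⟫_ℂ) atTop (𝓝 ⟪x, opTensor T S y⟫_ℂ) := by
  obtain ⟨M, hM⟩ := eventually_norm_le_of_isLUB f hf hT
  refine tendsto_inner_of_dense_span (M := M * ‖S‖) ?_ dense_span_elementaryTensors ?_ x y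
  · filter_upwards [hM] with a ha
    exact (norm_opTensor_le _ _).trans (by gcongr)
  · rintro _ ⟨a, b, rfl⟩ _ ⟨c, d, rfl⟩
    simpa using (tendsto_inner_of_isLUB f hf hT a c).mul_const ⟪b, S d⟫_ℂ

-- Expanding `(N* N) i j ⊗ S = ∑ k, (N k i ⊗ 1)* (1 ⊗ S) (N k j ⊗ 1)` turns the double sum into
-- values of the positive form of `1 ⊗ S`.
open scoped ComplexOrder in
lemma sum_inner_opTensor_nonneg (hS : 0 ≤ S) {n : Type*} [Fintype n]
    (N : CStarMatrix n n (K →L[ℂ] K)) (z : n → HTensor K V) :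
    0 ≤ ∑ i, ∑ j, ⟪z i, opTensor ((star N * N) i j) S (z j)⟫_ℂ := by
  have h : ∀ i j, opTensor ((star N * N) i j) S =
      ∑ k, (opTensor (N k i) 1).adjoint ∘L opTensor (1 : K →L[ℂ] K) S ∘L opTensor (N k j) 1 := by
    intro i j
    refine clm_ext_htmul fun a b => ?_
    simp only [CStarMatrix.mul_apply, CStarMatrix.star_apply, adjoint_opTensor, opTensor_htmul,
      sum_apply, ContinuousLinearMap.comp_apply, ContinuousLinearMap.star_eq_adjoint]
    rw [← htmulRight_apply, map_sum]
    simp [← ContinuousLinearMap.star_eq_adjoint]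
  have h2 : ∑ i, ∑ j, ⟪z i, opTensor ((star N * N) i j) S (z j)⟫_ℂ =
      ∑ k, ⟪∑ i, opTensor (N k i) 1 (z i),
        opTensor (1 : K →L[ℂ] K) S (∑ j, opTensor (N k j) 1 (z j))⟫_ℂ := by
    simp only [h, sum_apply, inner_sum, sum_inner, ContinuousLinearMap.comp_apply,
      ContinuousLinearMap.adjoint_inner_right, map_sum]
    rw [Finset.sum_comm_cycle]
    refine Finset.sum_congr rfl fun k _ => ?_
    rw [Finset.sum_comm]
  rw [h2]
  exact Finset.sum_nonneg fun k _ => nonneg_iff_inner_nonneg.1 (opTensor_one_left_nonneg hS) _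

lemma map_star_of_hasSum_inner_opTensor (hS : 0 ≤ S)
    (hΦ : ∀ T x y, HasSum (fun k => ⟪G k x, opTensor T S (G k y)⟫_ℂ) ⟪x, Φ T y⟫_ℂ)
    (T : K →L[ℂ] K) : Φ (star T) = star (Φ T) := by
  refine ContinuousLinearMap.ext fun y => ext_inner_left ℂ fun x => ?_
  rw [ContinuousLinearMap.star_eq_adjoint (Φ T), ContinuousLinearMap.adjoint_inner_right,
    ← inner_conj_symm (Φ T x) y]
  refine (hΦ (star T) x y).unique ?_
  have := (hΦ T y x).map (starRingEnd ℂ) Complex.continuous_conj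
  refine this.congr_fun fun k => ?_
  have hS' : S = S.adjoint := hS.isSelfAdjoint.star_eq.symm
  simp only [Function.comp_apply, inner_conj_symm]
  rw [← ContinuousLinearMap.adjoint_inner_right (opTensor T S), adjoint_opTensor, ← hS',
    ContinuousLinearMap.star_eq_adjoint]

open scoped ComplexOrder in
/-- A map of the form `T ↦ ∑ k, G k* (T ⊗ S) G k` is an operation if it is subunital. -/
lemma isOperation_of_hasSum_inner_opTensor (hG : Summable fun k => ‖G k‖ ^ 2) (hS : 0 ≤ S)
    (hΦ : ∀ T x y, HasSum (fun k => ⟪G k x, opTensor T S (G k y)⟫_ℂ) ⟪x, Φ T y⟫_ℂ)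
    (h1 : Φ 1 ≤ 1) : IsOperation Φ := by
  have hcp : ∀ (n : ℕ) (M : CStarMatrix (Fin n) (Fin n) (K →L[ℂ] K)), 0 ≤ M → 0 ≤ M.map Φ := by
    intro n M hM
    refine cstarMatrix_nonneg_of_sum_star_mul_mul_nonneg ?_ fun X => ?_
    · refine CStarMatrix.ext fun i j => ?_
      rw [CStarMatrix.star_apply, CStarMatrix.map_apply, CStarMatrix.map_apply,
        ← map_star_of_hasSum_inner_opTensor hS hΦ, ← CStarMatrix.star_apply,
        hM.isSelfAdjoint.star_eq]
    · obtain ⟨N, rfl⟩ := exists_eq_star_mul_self_of_nonneg hM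
      refine nonneg_iff_inner_nonneg.2 fun x => ?_
      have h : HasSum (fun k => ∑ i, ∑ j, ⟪G k (X i x), opTensor ((star N * N) i j) S
          (G k (X j x))⟫_ℂ) ⟪x, (∑ i, ∑ j, star (X i) * (star N * N).map Φ i j * X j) x⟫_ℂ := by
        have := hasSum_sum (s := Finset.univ) fun i (_ : i ∈ Finset.univ) =>
          hasSum_sum (s := Finset.univ) fun j (_ : j ∈ Finset.univ) =>
            hΦ ((star N * N) i j) (X i x) (X j x)
        rw [sum_apply, inner_sum]
        refine (congrArg (HasSum _) (Finset.sum_congr rfl fun i _ => ?_)).mp this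
        rw [sum_apply, inner_sum]
        refine Finset.sum_congr rfl fun j _ => ?_
        rw [mul_assoc, mul_apply_eq_comp, ContinuousLinearMap.star_eq_adjoint,
          ContinuousLinearMap.adjoint_inner_right]
        rfl
      exact h.nonneg fun k => sum_inner_opTensor_nonneg hS N _
  let φ : (K →L[ℂ] K) →CP (H →L[ℂ] H) := ⟨Φ, hcp⟩
  have hmono : Monotone Φ := OrderHomClass.mono φ
  refine ⟨⟨φ, rfl⟩, ?_, h1⟩
  intro d hne hdir T hT
  refine ⟨?_, fun B hB => ?_⟩
  · rintro _ ⟨a, ha, rfl⟩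
    exact hmono (hT.1 ha)
  · have : Nonempty d := hne.to_subtype
    have : IsDirectedOrder d := ⟨fun a b => by
      obtain ⟨c, hc, hac, hbc⟩ := hdir a a.2 b b.2
      exact ⟨⟨c, hc⟩, hac, hbc⟩⟩
    have hf : Monotone (Subtype.val : d → K →L[ℂ] K) := fun a b h => h
    have hT' : IsLUB (Set.range (Subtype.val : d → K →L[ℂ] K)) T := by
      rwa [Subtype.range_coe]
    obtain ⟨M, hM⟩ := eventually_norm_le_of_isLUB _ hf hT'
    have ht : ∀ x, Tendsto (fun a : d => ⟪x, Φ a x⟫_ℂ) atTop (𝓝 ⟪x, Φ T x⟫_ℂ) := by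
      intro x
      simp only [← (hΦ _ x x).tsum_eq]
      -- Summability of `‖G k‖²` and the tail bound `M` dominate the terms, so the limit along the
      -- net passes through the sum over `k`.
      refine tendsto_tsum_of_dominated_convergence
        (bound := fun k => ‖G k‖ ^ 2 * (M * ‖S‖ * ‖x‖ ^ 2)) (hG.mul_right _) (fun k =>
          tendsto_inner_opTensor_of_isLUB _ hf hT' S (G k x) (G k x)) ?_
      filter_upwards [hM] with a ha k
      calc ‖⟪G k x, opTensor (a : K →L[ℂ] K) S (G k x)⟫_ℂ‖
          ≤ ‖G k x‖ * (‖opTensor (a : K →L[ℂ] K) S‖ * ‖G k x‖) :=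
            (norm_inner_le_norm _ _).trans (by gcongr; exact ContinuousLinearMap.le_opNorm _ _)
        _ ≤ (‖G k‖ * ‖x‖) * ((M * ‖S‖) * (‖G k‖ * ‖x‖)) := by
            have h1 := (G k).le_opNorm x
            have h2 : ‖opTensor (a : K →L[ℂ] K) S‖ ≤ M * ‖S‖ :=
              (norm_opTensor_le _ _).trans (by gcongr)
            have h3 : 0 ≤ M * ‖S‖ := (norm_nonneg (opTensor (a : K →L[ℂ] K) S)).trans h2
            gcongr
        _ = _ := by ring
    rw [← sub_nonneg, nonneg_iff_inner_nonneg]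
    intro x
    simp only [sub_apply, inner_sub_right]
    refine ge_of_tendsto' (tendsto_const_nhds.sub (ht x)) fun a => ?_
    rw [← inner_sub_right, ← sub_apply]
    exact nonneg_iff_inner_nonneg.1 (sub_nonneg.2 (hB ⟨a, a.2, rfl⟩)) x

end Criterion

/-! ### Traces and partial traces in arbitrary bases. -/

section PartialTrace

variable {H : Type u₁} {V : Type v} {κ : Type*}
  [NormedAddCommGroup H] [InnerProductSpace ℂ H] [CompleteSpace H]
  [NormedAddCommGroup V] [InnerProductSpace ℂ V] [CompleteSpace V]

omit [CompleteSpace V] in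
lemma hasSum_norm_inner_sq {ι : Type*} (b : HilbertBasis ι ℂ V) (x : V) :
    HasSum (fun i => ‖⟪x, b i⟫_ℂ‖ ^ 2) (‖x‖ ^ 2) := by
  have h := Complex.hasSum_re (b.hasSum_inner_mul_inner x x)
  have h1 : (⟪x, x⟫_ℂ).re = ‖x‖ ^ 2 := (norm_sq_eq_re_inner (𝕜 := ℂ) x).symm
  rw [h1] at h
  refine h.congr_fun fun i => ?_
  rw [← inner_conj_symm (b i) x, Complex.mul_conj, Complex.normSq_eq_norm_sq, Complex.ofReal_re]

/-- The trace of `η w`, where `η = ∑ k, |g k⟩⟨g k|`, can be computed in every Hilbert basis. -/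
lemma hasSum_inner_hilbertBasis {η w : V →L[ℂ] V} {g : κ → V} (hg : Summable fun k => ‖g k‖ ^ 2)
    (hη : ∀ x y, HasSum (fun k => ⟪x, g k⟫_ℂ * ⟪g k, y⟫_ℂ) ⟪x, η y⟫_ℂ) {t : ℂ}
    (ht : HasSum (fun k => ⟪g k, w (g k)⟫_ℂ) t) {ι : Type*} (b : HilbertBasis ι ℂ V) :
    HasSum (fun i => ⟪b i, η (w (b i))⟫_ℂ) t := by
  let F : κ × ι → ℂ := fun p => ⟪w.adjoint (g p.1), b p.2⟫_ℂ * ⟪b p.2, g p.1⟫_ℂ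
  -- This majorant of `F` is summable by Parseval in `ι`, so the sum of `F` over `κ × ι` may be
  -- taken in either order: one order gives `t`, the other the trace in the basis `b`.
  let D : κ × ι → ℝ := fun p => ‖⟪w.adjoint (g p.1), b p.2⟫_ℂ‖ ^ 2 + ‖⟪g p.1, b p.2⟫_ℂ‖ ^ 2
  have hD : ∀ k, HasSum (fun i => D (k, i)) (‖w.adjoint (g k)‖ ^ 2 + ‖g k‖ ^ 2) := fun k => by
    have h1 := hasSum_norm_inner_sq b (w.adjoint (g k))
    have h2 := hasSum_norm_inner_sq b (g k)
    exact h1.add h2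
  have hDs : Summable D := by
    have hw : Summable fun k => ‖w.adjoint (g k)‖ ^ 2 := by
      refine Summable.of_nonneg_of_le (fun k => by positivity) (fun k => ?_)
        (hg.mul_left (‖w.adjoint‖ ^ 2))
      rw [← mul_pow]
      gcongr
      exact w.adjoint.le_opNorm _
    have hnn : 0 ≤ D := fun p => add_nonneg (sq_nonneg _) (sq_nonneg _)
    refine (summable_prod_of_nonneg hnn).2 ⟨fun k => (hD k).summable, ?_⟩
    exact (hw.add hg).congr fun k => (hD k).tsum_eq.symm
  have hF : Summable F := by
    refine Summable.of_norm_bounded hDs fun p => ?_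
    rw [norm_mul, ← norm_inner_symm (g p.1)]
    nlinarith [two_mul_le_add_sq ‖⟪w.adjoint (g p.1), b p.2⟫_ℂ‖ ‖⟪g p.1, b p.2⟫_ℂ‖,
      norm_nonneg ⟪w.adjoint (g p.1), b p.2⟫_ℂ, norm_nonneg ⟪g p.1, b p.2⟫_ℂ]
  obtain ⟨s, hs⟩ := hF
  have h1 : ∀ k, HasSum (fun i => F (k, i)) ⟪g k, w (g k)⟫_ℂ := fun k => by
    rw [← ContinuousLinearMap.adjoint_inner_left w]
    exact b.hasSum_inner_mul_inner (w.adjoint (g k)) (g k)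
  have hst : s = t := (hs.prod_fiberwise h1).unique ht
  have h2 : ∀ i, HasSum (fun k => F (k, i)) ⟪b i, η (w (b i))⟫_ℂ := fun i => by
    refine (hη (b i) (w (b i))).congr_fun fun k => ?_
    simp only [F]
    rw [ContinuousLinearMap.adjoint_inner_left, mul_comm]
  rw [← hst]
  exact ((Equiv.prodComm ι κ).hasSum_iff.2 hs).prod_fiberwise h2

/-- Fixing `x` and `y` compresses `W` to an operator `w` on `V`, which reduces the claim to the
scalar trace of `η w`. -/
lemma isPartialTrace_of_hasSum {η : V →L[ℂ] V} {g : κ → V} (hg : Summable fun k => ‖g k‖ ^ 2)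
    (hη : ∀ x y, HasSum (fun k => ⟪x, g k⟫_ℂ * ⟪g k, y⟫_ℂ) ⟪x, η y⟫_ℂ)
    {W : HTensor H V →L[ℂ] HTensor H V} {R : H →L[ℂ] H}
    (hR : ∀ x y, HasSum (fun k => ⟪htmul x (g k), W (htmul y (g k))⟫_ℂ) ⟪x, R y⟫_ℂ) :
    IsPartialTrace (opTensor 1 η ∘L W) R := by
  intro ι b x y
  let w : V →L[ℂ] V := (htmulL H V x).adjoint ∘L W ∘L htmulL H V y
  have hw : ∀ u u', ⟪u, w u'⟫_ℂ = ⟪htmul x u, W (htmul y u')⟫_ℂ := fun u u' =>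
    ContinuousLinearMap.adjoint_inner_right (htmulL H V x) u (W (htmul y u'))
  have ht : HasSum (fun k => ⟪g k, w (g k)⟫_ℂ) ⟪x, R y⟫_ℂ := by
    simpa only [hw] using hR x y
  have hb := hasSum_inner_hilbertBasis hg hη ht b
  have he : ∀ i, ⟪htmul x (b i), (opTensor 1 η ∘L W) (htmul y (b i))⟫_ℂ =
      ⟪b i, η (w (b i))⟫_ℂ := fun i => ?_
  · simpa only [he] using hb
  rw [← ContinuousLinearMap.adjoint_inner_left η, hw, ContinuousLinearMap.comp_apply,
    ← ContinuousLinearMap.adjoint_inner_left (opTensor 1 η), adjoint_opTensor, opTensor_htmul,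
    ← ContinuousLinearMap.star_eq_adjoint 1, star_one]
  rfl

omit [CompleteSpace H] in
lemma IsPartialTrace.unique {W : HTensor H V →L[ℂ] HTensor H V} {R R' : H →L[ℂ] H}
    (h : IsPartialTrace W R) (h' : IsPartialTrace W R') : R = R' := by
  obtain ⟨s, b, -⟩ := exists_hilbertBasis ℂ V
  exact ContinuousLinearMap.ext fun y => ext_inner_left ℂ fun x =>
    (h s b x y).unique (h' s b x y)

omit [CompleteSpace H] [CompleteSpace V] in
lemma IsPartialTrace.sum {ι : Type*} {s : Finset ι} {W : ι → HTensor H V →L[ℂ] HTensor H V}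
    {R : ι → H →L[ℂ] H} (h : ∀ i ∈ s, IsPartialTrace (W i) (R i)) :
    IsPartialTrace (∑ i ∈ s, W i) (∑ i ∈ s, R i) := by
  intro κ b x y
  simp only [sum_apply, inner_sum]
  exact hasSum_sum fun i hi => h i hi κ b x y

/-- A state is a sum of multiples of one-dimensional projections. -/
lemma State.exists_hasSum (η : State V) : ∃ (κ : Type v) (g : κ → V),
    (Summable fun k => ‖g k‖ ^ 2) ∧ (∑' k, ‖g k‖ ^ 2 = 1) ∧
      ∀ x y, HasSum (fun k => ⟪x, g k⟫_ℂ * ⟪g k, y⟫_ℂ) ⟪x, η.op y⟫_ℂ := by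
  obtain ⟨s, b, -⟩ := exists_hilbertBasis ℂ V
  -- The vectors `g k` are the images of a Hilbert basis under the square root of `η`; their squared
  -- norms sum to the trace of `η`.
  let r := CFC.sqrt η.op
  have hr : r.adjoint = r := (CFC.sqrt_nonneg η.op).isSelfAdjoint.star_eq
  have hrr : ∀ y, r (r y) = η.op y := fun y =>
    DFunLike.congr_fun (CFC.sqrt_mul_sqrt_self η.op η.nonneg) y
  have hin : ∀ x y, ⟪x, η.op y⟫_ℂ = ⟪r x, r y⟫_ℂ := fun x y => by
    rw [← hrr, ← ContinuousLinearMap.adjoint_inner_left, hr]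
  have h1 : HasSum (fun k : s => ‖r (b k)‖ ^ 2) 1 := by
    have := Complex.hasSum_re (η.trace_eq_one s b)
    refine this.congr_fun fun k => ?_
    rw [hin]
    exact (norm_sq_eq_re_inner (𝕜 := ℂ) _)
  refine ⟨s, fun k => r (b k), h1.summable, h1.tsum_eq, fun x y => ?_⟩
  rw [hin]
  refine (b.hasSum_inner_mul_inner (r x) (r y)).congr_fun fun k => ?_
  rw [← ContinuousLinearMap.adjoint_inner_left r, ← ContinuousLinearMap.adjoint_inner_right r, hr]

end PartialTrace

/-! ### Kraus operators and the instrument of a coupling. -/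

section Kraus

variable {H : Type u₁} {K : Type u₂} {V : Type v}
  [NormedAddCommGroup H] [InnerProductSpace ℂ H] [CompleteSpace H]
  [NormedAddCommGroup K] [InnerProductSpace ℂ K] [CompleteSpace K]
  [NormedAddCommGroup V] [InnerProductSpace ℂ V] [CompleteSpace V]
  {κ : Type*} {G : κ → H →L[ℂ] HTensor K V}

omit [CompleteSpace K] [CompleteSpace V] in
/-- The map `T ↦ ∑ k, G k* (T ⊗ S) G k` exists when the squared norms of the `G k` are summable. -/
lemma exists_hasSum_inner_opTensor (hG : Summable fun k => ‖G k‖ ^ 2) (S : V →L[ℂ] V) :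
    ∃ Φ : (K →L[ℂ] K) →ₗ[ℂ] (H →L[ℂ] H), ∀ T x y,
      HasSum (fun k => ⟪G k x, opTensor T S (G k y)⟫_ℂ) ⟪x, Φ T y⟫_ℂ := by
  let A : (K →L[ℂ] K) → κ → H →L[ℂ] H := fun T k => (G k).adjoint ∘L opTensor T S ∘L G k
  have hA : ∀ T, Summable (A T) := fun T => by
    refine Summable.of_norm_bounded (hG.mul_left ‖opTensor T S‖) fun k => ?_
    calc ‖A T k‖ ≤ ‖(G k).adjoint‖ * (‖opTensor T S‖ * ‖G k‖) :=
          (ContinuousLinearMap.opNorm_comp_le _ _).trans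
            (by gcongr; exact ContinuousLinearMap.opNorm_comp_le _ _)
      _ = _ := by rw [LinearIsometryEquiv.norm_map]; ring
  refine ⟨{ toFun := fun T => ∑' k, A T k
            map_add' := fun T T' => ?_
            map_smul' := fun c T => ?_ }, fun T x y => ?_⟩
  · rw [← (hA T).tsum_add (hA T')]
    refine tsum_congr fun k => ?_
    simp only [A, opTensor_add_left, ContinuousLinearMap.add_comp, ContinuousLinearMap.comp_add]
  · rw [RingHom.id_apply, ← (hA T).tsum_const_smul]
    refine tsum_congr fun k => ?_
    simp only [A, opTensor_smul_left, ContinuousLinearMap.smul_comp,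
      ContinuousLinearMap.comp_smul]
  · have h := (hA T).hasSum.mapL (innerSL ℂ x ∘L ContinuousLinearMap.apply ℂ H y)
    refine h.congr_fun fun k => ?_
    exact (ContinuousLinearMap.adjoint_inner_right (G k) x (opTensor T S (G k y))).symm

open scoped ComplexOrder in
/-- The instrument with Kraus operators `G` and pointer observable `F`. -/
lemma exists_instrument_of_hasSum (hG : Summable fun k => ‖G k‖ ^ 2)
    (h1 : ∀ x y, HasSum (fun k => ⟪G k x, G k y⟫_ℂ) ⟪x, y⟫_ℂ)
    {Ω : Type w} [Fintype Ω] (F : Observable Ω V) :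
    ∃ I : Instrument H K Ω, ∀ ω T x y,
      HasSum (fun k => ⟪G k x, opTensor T (F.toFun ω) (G k y)⟫_ℂ) ⟪x, I.toFun ω T y⟫_ℂ := by
  choose Φ hΦ using fun ω => exists_hasSum_inner_opTensor (K := K) hG (F.toFun ω)
  have hsum : ∀ T x y, HasSum (fun k => ⟪G k x, opTensor T 1 (G k y)⟫_ℂ)
      ⟪x, (∑ ω, Φ ω) T y⟫_ℂ := by
    intro T x y
    rw [← F.sum_eq_one, opTensor_sum_right, LinearMap.sum_apply, sum_apply, inner_sum]
    have := hasSum_sum (s := Finset.univ) fun ω _ => hΦ ω T x y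
    refine this.congr_fun fun k => ?_
    rw [sum_apply, inner_sum]
  have hone : (∑ ω, Φ ω) 1 = 1 := by
    refine ContinuousLinearMap.ext fun y => ext_inner_left ℂ fun x => ?_
    refine (hsum 1 x y).unique ((h1 x y).congr_fun fun k => ?_)
    rw [opTensor_one_one]; rfl
  have hle : ∀ ω, Φ ω 1 ≤ 1 := by
    intro ω
    have hnn : ∀ ω', 0 ≤ Φ ω' 1 := fun ω' => by
      refine nonneg_iff_inner_nonneg.2 fun x => (hΦ ω' 1 x x).nonneg fun k => ?_
      exact nonneg_iff_inner_nonneg.1 (opTensor_one_left_nonneg (F.isEffect ω').1) _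
    rw [← hone, LinearMap.sum_apply]
    exact Finset.single_le_sum (fun i _ => hnn i) (Finset.mem_univ ω)
  exact ⟨⟨Φ, fun ω => isOperation_of_hasSum_inner_opTensor hG (F.isEffect ω).1 (hΦ ω) (hle ω),
    isOperation_of_hasSum_inner_opTensor hG zero_le_one hsum hone.le, hone⟩, hΦ⟩

variable (C : Coupling.{u₁, u₂, v} H K)

-- The Kraus operators are `U (· ⊗ g k)`, where `η = ∑ |g k⟩⟨g k|`; trace one makes `∑ G k* G k =
-- 1`.
omit [CompleteSpace K] in
lemma Coupling.exists_kraus : ∃ (κ : Type v) (G : κ → H →L[ℂ] HTensor K C.V₂),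
    (Summable fun k => ‖G k‖ ^ 2) ∧
    (∀ x y, HasSum (fun k => ⟪G k x, G k y⟫_ℂ) ⟪x, y⟫_ℂ) ∧
    ∀ T S R, (∀ x y, HasSum (fun k => ⟪G k x, opTensor T S (G k y)⟫_ℂ) ⟪x, R y⟫_ℂ) →
      IsPartialTrace (C.evolve T S) R := by
  obtain ⟨κ, g, hg, hg1, hη⟩ := C.η.exists_hasSum
  let U : HTensor H C.V₁ →L[ℂ] HTensor K C.V₂ := C.U.toContinuousLinearEquiv
  refine ⟨κ, fun k => U ∘L htmulRight (g k), ?_, fun x y => ?_, fun T S R hR => ?_⟩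
  · refine Summable.of_nonneg_of_le (fun k => by positivity) (fun k => ?_) hg
    gcongr
    refine ContinuousLinearMap.opNorm_le_bound _ (norm_nonneg _) fun x => ?_
    calc ‖C.U (htmul x (g k))‖ = ‖x‖ * ‖g k‖ := by rw [LinearIsometryEquiv.norm_map, norm_htmul]
      _ ≤ _ := by rw [mul_comm]
  · have h2 : HasSum (fun k => ((‖g k‖ ^ 2 : ℝ) : ℂ)) 1 := by
      have := hg.hasSum
      rw [hg1] at this
      have h4 := Complex.ofRealCLM.hasSum this
      rwa [Complex.ofRealCLM_apply, Complex.ofReal_one] at h4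
    have h3 := h2.mul_left ⟪x, y⟫_ℂ
    rw [mul_one] at h3
    refine h3.congr_fun fun k => ?_
    change ⟪C.U (htmul x (g k)), C.U (htmul y (g k))⟫_ℂ = _
    rw [LinearIsometryEquiv.inner_map_map, inner_htmul_htmul, inner_self_eq_norm_sq_to_K]
    simp
  · refine isPartialTrace_of_hasSum hg hη fun x y => (hR x y).congr_fun fun k => ?_
    exact ContinuousLinearMap.adjoint_inner_right U (htmul x (g k))
      (opTensor T S (U (htmul y (g k))))

omit [CompleteSpace H] [CompleteSpace K] in
lemma Coupling.evolve_sum {ι : Type*} (s : Finset ι) (T : K →L[ℂ] K)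
    (S : ι → C.V₂ →L[ℂ] C.V₂) :
    C.evolve T (∑ i ∈ s, S i) = ∑ i ∈ s, C.evolve T (S i) := by
  simp only [Coupling.evolve, opTensor_sum_right]
  refine ContinuousLinearMap.ext fun z => ?_
  simp only [ContinuousLinearMap.comp_apply, sum_apply, map_sum]

/-- A coupling and a pointer observable define an instrument. -/
lemma Coupling.exists_instrument {Ω : Type w} [Fintype Ω] (F : Observable Ω C.V₂) :
    ∃ I : Instrument H K Ω, ∀ X T, IsPartialTrace (C.evolve T (F.onSet X)) (I.onSet X T) := by
  obtain ⟨κ, G, hG, h1, hC⟩ := C.exists_kraus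
  obtain ⟨I, hI⟩ := exists_instrument_of_hasSum hG h1 F
  refine ⟨I, fun X T => ?_⟩
  rw [Observable.onSet, Instrument.onSet, C.evolve_sum, LinearMap.sum_apply]
  exact IsPartialTrace.sum fun ω _ => hC T _ _ (hI ω T)

end Kraus

/-! ### Comparison of the parts of models and of instruments. -/

section Parts

variable {H : Type u₁} {K : Type u₂}
  [NormedAddCommGroup H] [InnerProductSpace ℂ H] [CompleteSpace H]
  [NormedAddCommGroup K] [InnerProductSpace ℂ K] [CompleteSpace K]

lemma Observable.onSet_univ {Ω : Type w} [Fintype Ω] (A : Observable Ω H) :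
    A.onSet Finset.univ = 1 := A.sum_eq_one

/-- An instrument has a channel as a part only if the channel is its total channel. -/
lemma Instrument.onSet_eq_onSet_univ {Ω : Type w} [Fintype Ω] (I : Instrument H K Ω)
    {X : Finset Ω} (hX : I.onSet X 1 = 1) : I.onSet X = I.onSet Finset.univ := by
  classical
  have hsplit : I.onSet X + ∑ x ∈ Xᶜ, I.toFun x = I.onSet Finset.univ :=
    Finset.sum_add_sum_compl X I.toFun
  have h1 : I.onSet Finset.univ 1 = 1 := I.isChannel.2
  have h0 : ∑ x ∈ Xᶜ, I.toFun x 1 = 0 := by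
    rw [← hsplit, LinearMap.add_apply, hX, LinearMap.sum_apply] at h1
    simpa using h1
  have hnn : ∀ x ∈ Xᶜ, 0 ≤ I.toFun x 1 := fun x _ => by
    have := (I.isOperation x).monotone (zero_le_one (α := K →L[ℂ] K))
    rwa [map_zero] at this
  -- Outside `X` the positive operators `I(x, 1)` sum to zero, so each vanishes, and an operation
  -- vanishing at `1` is zero by Cauchy–Schwarz.
  rw [← hsplit, Finset.sum_eq_zero fun x hx => (I.isOperation x).eq_zero_of_map_one
    ((Finset.sum_eq_zero_iff_of_nonneg hnn).1 h0 x hx), add_zero]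

/-- A measurement model and an instrument that it realizes have the same parts. -/
lemma Device.isPartOfModel_iff (M : MeasurementModel.{u₁, u₂, v, w} H K)
    (I : Instrument H K M.Ω)
    (hI : ∀ X T, IsPartialTrace (M.evolve T (M.F.onSet X)) (I.onSet X T))
    (D : Device.{u₁, u₂, w} H K) : D.IsPartOfModel M ↔ D.IsPartOfInstrument I := by
  have key : ∀ X T R, IsPartialTrace (M.evolve T (M.F.onSet X)) R ↔ R = I.onSet X T :=
    fun X T R => ⟨fun h => h.unique (hI X T), fun h => h ▸ hI X T⟩
  cases D with
  | effect E hE => exact exists_congr fun X => key X 1 E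
  | observable Ω' _ A => exact exists_congr fun f => forall_congr' fun X => key _ 1 _
  | operation Φ hΦ =>
    exact exists_congr fun X => (forall_congr' fun T => key X T _).trans LinearMap.ext_iff.symm
  | channel Λ hΛ =>
    have h : (Device.channel Λ hΛ).IsPartOfModel M ↔ Λ = I.onSet Finset.univ := by
      rw [LinearMap.ext_iff]
      refine forall_congr' fun T => ?_
      rw [← key, Observable.onSet_univ]
    rw [h]
    refine ⟨fun h => ⟨_, h⟩, ?_⟩
    rintro ⟨X, hX⟩
    rw [hX, I.onSet_eq_onSet_univ]
    rw [← hX, hΛ.2]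
  | instrument Ω' _ I' =>
    exact exists_congr fun f => forall_congr' fun X =>
      (forall_congr' fun T => key _ T _).trans LinearMap.ext_iff.symm

/-- Devices that are parts of measurement models with the same coupling are parts of instruments
with the same total channel. -/
lemma weaklyCompatible_of_isPartOfModel {M₁ M₂ : MeasurementModel.{u₁, u₂, v, w} H K}
    (hM : M₁.DifferOnlyInPointer M₂) {D₁ D₂ : Device.{u₁, u₂, w} H K}
    (h₁ : D₁.IsPartOfModel M₁) (h₂ : D₂.IsPartOfModel M₂) : WeaklyCompatible D₁ D₂ := by
  obtain ⟨C₁, Ω₁, F₁⟩ := M₁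
  obtain ⟨C₂, Ω₂, F₂⟩ := M₂
  obtain rfl : C₁ = C₂ := hM
  obtain ⟨I₁, hI₁⟩ := C₁.exists_instrument F₁
  obtain ⟨I₂, hI₂⟩ := C₁.exists_instrument F₂
  refine ⟨Ω₁, Ω₂, _, _, I₁, I₂, (Device.isPartOfModel_iff _ I₁ hI₁ D₁).1 h₁,
    (Device.isPartOfModel_iff _ I₂ hI₂ D₂).1 h₂, LinearMap.ext fun T => ?_⟩
  -- On the full outcome set each pointer gives `1`, so both total channels are the same partial
  -- trace.
  have h1 := hI₁ Finset.univ T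
  have h2 := hI₂ Finset.univ T
  rw [Observable.onSet_univ] at h1 h2
  exact h1.unique h2

lemma compatible_of_isPartOfModel {M : MeasurementModel.{u₁, u₂, v, w} H K}
    {D₁ D₂ : Device.{u₁, u₂, w} H K}
    (h₁ : D₁.IsPartOfModel M) (h₂ : D₂.IsPartOfModel M) : Compatible D₁ D₂ := by
  obtain ⟨I, hI⟩ := M.exists_instrument M.F
  exact ⟨M.Ω, _, I, (D₁.isPartOfModel_iff M I hI).1 h₁, (D₂.isPartOfModel_iff M I hI).1 h₂⟩

end Parts

/-! ### Normal maps are determined by matrix units. -/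

section MatrixUnits

open InnerProductSpace (rankOne)

variable {H : Type u₁} {K : Type u₂} {ι : Type*}
  [NormedAddCommGroup H] [InnerProductSpace ℂ H] [CompleteSpace H]
  [NormedAddCommGroup K] [InnerProductSpace ℂ K] [CompleteSpace K]

/-- The orthogonal projection onto the span of finitely many vectors of a Hilbert basis. -/
def basisProj (b : HilbertBasis ι ℂ K) (s : Finset ι) : K →L[ℂ] K :=
  ∑ i ∈ s, rankOne ℂ (b i) (b i)

variable (b : HilbertBasis ι ℂ K)

omit [CompleteSpace K] in
lemma basisProj_apply (s : Finset ι) (x : K) :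
    basisProj b s x = ∑ i ∈ s, ⟪b i, x⟫_ℂ • b i := by
  simp [basisProj, sum_apply, InnerProductSpace.rankOne_apply]

lemma star_basisProj (s : Finset ι) : star (basisProj b s) = basisProj b s := by
  simp [basisProj, star_sum, ContinuousLinearMap.star_eq_adjoint]

omit [CompleteSpace K] in
lemma basisProj_mul_self (s : Finset ι) : basisProj b s * basisProj b s = basisProj b s := by
  classical
  refine ContinuousLinearMap.ext fun x => ?_
  rw [mul_apply_eq_comp, basisProj_apply, basisProj_apply b s x]
  refine Finset.sum_congr rfl fun i hi => ?_
  rw [b.orthonormal.inner_right_sum _ hi]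

lemma one_sub_basisProj_eq (s : Finset ι) :
    star (1 - basisProj b s) * (1 - basisProj b s) = 1 - basisProj b s := by
  rw [star_sub, star_one, star_basisProj, sub_mul, mul_sub, mul_sub, basisProj_mul_self]
  simp

lemma monotone_basisProj : Monotone (basisProj b) := fun s t hst => by
  refine Finset.sum_le_sum_of_subset_of_nonneg hst fun i _ _ => ?_
  rw [ContinuousLinearMap.nonneg_iff_isPositive]
  exact InnerProductSpace.isPositive_rankOne_self _

lemma basisProj_le_one (s : Finset ι) : basisProj b s ≤ 1 := by
  rw [← sub_nonneg, ← one_sub_basisProj_eq]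
  exact star_mul_self_nonneg (1 - basisProj b s)

omit [CompleteSpace K] in
lemma tendsto_basisProj (x : K) : Tendsto (fun s => basisProj b s x) atTop (𝓝 x) := by
  have h := b.hasSum_repr x
  simp only [b.repr_apply_apply] at h
  simp only [basisProj_apply]
  exact h

open scoped ComplexOrder in
lemma isLUB_basisProj : IsLUB (Set.range (basisProj b)) 1 := by
  refine ⟨?_, fun B hB => ?_⟩
  · rintro _ ⟨s, rfl⟩
    exact basisProj_le_one b s
  · rw [← sub_nonneg, nonneg_iff_inner_nonneg]
    intro x
    have h : Tendsto (fun s => ⟪x, (B - basisProj b s) x⟫_ℂ) atTop (𝓝 ⟪x, (B - 1) x⟫_ℂ) :=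
      tendsto_const_nhds.inner (tendsto_const_nhds.sub (tendsto_basisProj b x))
    exact ge_of_tendsto' h fun s =>
      nonneg_iff_inner_nonneg.1 (sub_nonneg.2 (hB ⟨s, rfl⟩)) x

variable {Φ Ψ : (K →L[ℂ] K) →ₗ[ℂ] (H →L[ℂ] H)}

lemma IsOperation.tendsto_inner_map_basisProj (hΦ : IsOperation Φ) (x y : H) :
    Tendsto (fun s => ⟪x, Φ (basisProj b s) y⟫_ℂ) atTop (𝓝 ⟪x, Φ 1 y⟫_ℂ) := by
  refine tendsto_inner_of_isLUB (fun s => Φ (basisProj b s))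
    (hΦ.monotone.comp (monotone_basisProj b)) ?_ x y
  have := hΦ.2.1 (Set.range_nonempty _) (monotone_basisProj b).directed_le.directedOn_range
    (isLUB_basisProj b)
  rwa [← Set.range_comp] at this

lemma IsOperation.tendsto_re_inner_map_one_sub (hΦ : IsOperation Φ) (x : H) :
    Tendsto (fun s => (⟪x, Φ (1 - basisProj b s) x⟫_ℂ).re) atTop (𝓝 0) := by
  have h := (Complex.continuous_re.tendsto _).comp
    ((tendsto_const_nhds (x := ⟪x, Φ 1 x⟫_ℂ)).sub (hΦ.tendsto_inner_map_basisProj b x x))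
  rw [sub_self, Complex.zero_re] at h
  refine h.congr fun s => ?_
  rw [Function.comp_apply, map_sub, sub_apply, inner_sub_right]

lemma tendsto_zero_of_norm_sq_le {α : Type*} {l : Filter α} {f : α → ℂ} {g : α → ℝ} {c : ℝ}
    (h : ∀ a, ‖f a‖ ^ 2 ≤ g a * c) (hg : Tendsto g l (𝓝 0)) : Tendsto f l (𝓝 0) := by
  have h0 : Tendsto (fun a => ‖f a‖ ^ 2) l (𝓝 0) :=
    squeeze_zero (fun a => by positivity) h (by simpa using hg.mul_const c)
  have h1 := (Real.continuous_sqrt.tendsto _).comp h0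
  rw [Real.sqrt_zero] at h1
  refine tendsto_zero_iff_norm_tendsto_zero.2 (h1.congr fun a => ?_)
  simp

/-- By Cauchy–Schwarz, `|⟪x, Φ ((1 - P) T) y⟫|²` is at most `⟪x, Φ (1 - P) x⟫` times a constant, and
the first factor tends to zero by normality. -/
lemma IsOperation.tendsto_inner_map_basisProj_mul (hΦ : IsOperation Φ) (T : K →L[ℂ] K) (x y : H) :
    Tendsto (fun s => ⟪x, Φ (basisProj b s * T) y⟫_ℂ) atTop (𝓝 ⟪x, Φ T y⟫_ℂ) := by
  have h := tendsto_zero_of_norm_sq_le (l := atTop)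
    (fun s => hΦ.norm_inner_sq_le (1 - basisProj b s) T x y) (by
      simp only [one_sub_basisProj_eq]
      exact hΦ.tendsto_re_inner_map_one_sub b x)
  have h' := (tendsto_const_nhds (x := ⟪x, Φ T y⟫_ℂ)).sub h
  rw [sub_zero] at h'
  refine h'.congr fun s => ?_
  rw [← inner_sub_right, ← sub_apply, ← map_sub, star_sub, star_one, star_basisProj, sub_mul,
    one_mul, sub_sub_cancel]

lemma IsOperation.tendsto_inner_map_mul_basisProj (hΦ : IsOperation Φ) (T : K →L[ℂ] K) (x y : H) :
    Tendsto (fun s => ⟪x, Φ (T * basisProj b s) y⟫_ℂ) atTop (𝓝 ⟪x, Φ T y⟫_ℂ) := by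
  have h := tendsto_zero_of_norm_sq_le (l := atTop)
    (fun s => (hΦ.norm_inner_sq_le (star T) (1 - basisProj b s) x y).trans_eq (mul_comm _ _)) (by
      simp only [one_sub_basisProj_eq]
      exact hΦ.tendsto_re_inner_map_one_sub b y)
  have h' := (tendsto_const_nhds (x := ⟪x, Φ T y⟫_ℂ)).sub h
  rw [sub_zero] at h'
  refine h'.congr fun s => ?_
  rw [← inner_sub_right, ← sub_apply, ← map_sub, star_star, mul_sub, mul_one, sub_sub_cancel]

omit [CompleteSpace K] in
lemma rankOne_mul_mul_rankOne (T : K →L[ℂ] K) (x y : K) :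
    rankOne ℂ x x * T * rankOne ℂ y y = ⟪x, T y⟫_ℂ • rankOne ℂ x y := by
  refine ContinuousLinearMap.ext fun z => ?_
  simp only [mul_apply_eq_comp, InnerProductSpace.rankOne_apply, map_smul, smul_apply]
  rw [smul_comm]

/-- Operations are determined by their values on matrix units. -/
lemma IsOperation.ext_rankOne (hΦ : IsOperation Φ) (hΨ : IsOperation Ψ)
    (h : ∀ i j, Φ (rankOne ℂ (b i) (b j)) = Ψ (rankOne ℂ (b i) (b j))) : Φ = Ψ := by
  -- The cut-off `P_s T P_t` is a finite combination of matrix units; the limits are then removed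
  -- one side at a time.
  have h1 : ∀ s t T, Φ (basisProj b s * (T * basisProj b t)) =
      Ψ (basisProj b s * (T * basisProj b t)) := by
    intro s t T
    simp only [← mul_assoc, basisProj, Finset.sum_mul, Finset.mul_sum, rankOne_mul_mul_rankOne,
      map_sum, map_smul, h]
  refine LinearMap.ext fun T => ContinuousLinearMap.ext fun y => ext_inner_left ℂ fun x => ?_
  refine tendsto_nhds_unique (hΦ.tendsto_inner_map_mul_basisProj b T x y)
    ((hΨ.tendsto_inner_map_mul_basisProj b T x y).congr fun t => ?_)
  refine tendsto_nhds_unique (hΨ.tendsto_inner_map_basisProj_mul b _ x y)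
    ((hΦ.tendsto_inner_map_basisProj_mul b _ x y).congr fun s => ?_)
  rw [h1]

end MatrixUnits

/-! ### Radon–Nikodym theorem for operator-valued kernels. -/

section RadonNikodym

open RKHS

lemma eq_of_inner_dense_span {E : Type*} [NormedAddCommGroup E] [InnerProductSpace ℂ E] {s : Set E}
    (hs : Dense (Submodule.span ℂ s : Set E)) {x y : E} (h : ∀ z ∈ s, ⟪x, z⟫_ℂ = ⟪y, z⟫_ℂ) :
    x = y := by
  refine ext_inner_right ℂ fun z => ?_
  exact DFunLike.congr_fun
    (ContinuousLinearMap.ext_on (f := innerSL ℂ x) (g := innerSL ℂ y) hs h) z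

variable {H : Type u₁} [NormedAddCommGroup H] [InnerProductSpace ℂ H] [CompleteSpace H]
  {X : Type v}

section

variable (k : Matrix X X (H →L[ℂ] H)) [Fact k.PosSemidef]

lemma inner_kerFun_kerFun (x y : X) (u w : H) :
    ⟪kerFun (OfKernel k) x u, kerFun (OfKernel k) y w⟫_ℂ = ⟪u, k x y w⟫_ℂ := by
  rw [kerFun_inner, kerFun_apply, OfKernel.kernel_ofKernel]

/-- The kernel vectors of the reproducing kernel Hilbert space of `k`. -/
def kerVectors : Set (OfKernel k) := {f | ∃ x u, kerFun (OfKernel k) x u = f}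

lemma dense_span_kerVectors : Dense (Submodule.span ℂ (kerVectors k) : Set (OfKernel k)) :=
  Submodule.dense_iff_topologicalClosure_eq_top.2 (kerFun_dense (𝕜 := ℂ) (OfKernel k))

lemma separableSpace_ofKernel [Countable X] [TopologicalSpace.SeparableSpace H] :
    TopologicalSpace.SeparableSpace (OfKernel k) := by
  have h : kerVectors k = ⋃ x, Set.range (kerFun (OfKernel k) x) := by
    ext f
    simp [kerVectors]
  have hs : TopologicalSpace.IsSeparable (kerVectors k) := by
    rw [h]
    exact TopologicalSpace.IsSeparable.iUnion fun x =>
      TopologicalSpace.isSeparable_range (kerFun (OfKernel k) x).continuous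
  have := hs.span (R := ℂ).closure
  rw [(dense_span_kerVectors k).closure_eq] at this
  exact TopologicalSpace.isSeparable_univ_iff.1 this

/-- The map sending a finitely supported function `f` to `∑ x, k_x (f x)`. -/
def kerSum : (X →₀ H) →ₗ[ℂ] OfKernel k :=
  Finsupp.lsum ℂ fun x => (kerFun (OfKernel k) x : H →ₗ[ℂ] OfKernel k)

lemma kerSum_single (x : X) (u : H) : kerSum k (Finsupp.single x u) = kerFun (OfKernel k) x u := by
  simp [kerSum]

lemma denseRange_kerSum : DenseRange (kerSum k) := by
  refine (dense_span_kerVectors k).mono ?_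
  have h : Submodule.span ℂ (kerVectors k) ≤ LinearMap.range (kerSum k) := by
    rw [Submodule.span_le]
    rintro _ ⟨x, u, rfl⟩
    exact ⟨_, kerSum_single k x u⟩
  exact h

lemma norm_kerSum_sq (f : X →₀ H) :
    ‖kerSum k f‖ ^ 2 = (f.sum fun x u => f.sum fun y w => ⟪u, k x y w⟫_ℂ).re := by
  have h : ⟪kerSum k f, kerSum k f⟫_ℂ = f.sum fun x u => f.sum fun y w => ⟪u, k x y w⟫_ℂ := by
    simp only [kerSum, Finsupp.lsum_apply, Finsupp.sum, sum_inner, inner_sum]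
    rw [Finset.sum_comm]
    exact Finset.sum_congr rfl fun x _ => Finset.sum_congr rfl fun y _ =>
      inner_kerFun_kerFun k x y (f x) (f y)
  rw [← h]
  exact norm_sq_eq_re_inner (𝕜 := ℂ) (kerSum k f)

end

/-- If `k - k'` is positive semidefinite, then `k'` is represented by a positive operator on the
reproducing kernel Hilbert space of `k`. -/
lemma exists_nonneg_of_sub_posSemidef (k k' : Matrix X X (H →L[ℂ] H)) [hk : Fact k.PosSemidef]
    (hk' : k'.PosSemidef) (hsub : (k - k').PosSemidef) :
    ∃ F : OfKernel k →L[ℂ] OfKernel k, 0 ≤ F ∧ ∀ x y u w,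
      ⟪kerFun (OfKernel k) x u, F (kerFun (OfKernel k) y w)⟫_ℂ = ⟪u, k' x y w⟫_ℂ := by
  have : Fact k'.PosSemidef := ⟨hk'⟩
  have : Fact (k - k').PosSemidef := ⟨hsub⟩
  -- The difference of the squared norms is the squared norm of `f` in the space of `k - k'`.
  have hle : ∀ f, ‖kerSum k' f‖ ≤ 1 * ‖kerSum k f‖ := fun f => by
    rw [one_mul]
    refine (pow_le_pow_iff_left₀ (norm_nonneg (kerSum k' f)) (norm_nonneg (kerSum k f))
      two_ne_zero).1 ?_
    have h := norm_kerSum_sq (k - k') f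
    have h2 : (f.sum fun x u => f.sum fun y w => ⟪u, (k - k') x y w⟫_ℂ) =
        (f.sum fun x u => f.sum fun y w => ⟪u, k x y w⟫_ℂ) -
        (f.sum fun x u => f.sum fun y w => ⟪u, k' x y w⟫_ℂ) := by
      simp only [Matrix.sub_apply, sub_apply, inner_sub_right, Finsupp.sum_sub]
    rw [h2, Complex.sub_re, ← norm_kerSum_sq, ← norm_kerSum_sq] at h
    nlinarith [sq_nonneg ‖kerSum (k - k') f‖]
  -- The contraction carrying kernel vectors of `k` to those of `k'`; the desired operator is `c*
  -- c`.
  let c : OfKernel k →L[ℂ] OfKernel k' := (kerSum k').extendOfNorm (kerSum k)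
  have hc : ∀ x u, c (kerFun (OfKernel k) x u) = kerFun (OfKernel k') x u := fun x u => by
    rw [← kerSum_single, ← kerSum_single]
    exact LinearMap.extendOfNorm_eq (denseRange_kerSum k) ⟨1, hle⟩ _
  refine ⟨c.adjoint ∘L c, ?_, fun x y u w => ?_⟩
  · rw [ContinuousLinearMap.nonneg_iff_isPositive]
    exact ContinuousLinearMap.isPositive_adjoint_comp_self c
  · rw [ContinuousLinearMap.comp_apply, ContinuousLinearMap.adjoint_inner_right, hc, hc,
      inner_kerFun_kerFun]

/-- A decomposition of a kernel into positive semidefinite kernels comes from a decomposition of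
the identity of the reproducing kernel Hilbert space. -/
lemma exists_decomposition_of_sum_eq {Ω : Type w} [Fintype Ω] (k : Matrix X X (H →L[ℂ] H))
    [hk : Fact k.PosSemidef] (k' : Ω → Matrix X X (H →L[ℂ] H)) (hk' : ∀ ω, (k' ω).PosSemidef)
    (hsum : ∑ ω, k' ω = k) :
    ∃ F : Ω → OfKernel k →L[ℂ] OfKernel k, (∀ ω, 0 ≤ F ω) ∧ ∑ ω, F ω = 1 ∧ ∀ ω x y u w,
      ⟪kerFun (OfKernel k) x u, F ω (kerFun (OfKernel k) y w)⟫_ℂ = ⟪u, k' ω x y w⟫_ℂ := by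
  classical
  have hsub : ∀ ω, (k - k' ω).PosSemidef := fun ω => by
    have : k - k' ω = ∑ ω' ∈ Finset.univ.erase ω, k' ω' := by
      rw [← hsum, ← Finset.add_sum_erase _ _ (Finset.mem_univ ω), add_sub_cancel_left]
    rw [this]
    exact Matrix.posSemidef_sum _ fun ω' _ => hk' ω'
  choose F hF0 hF using fun ω => exists_nonneg_of_sub_posSemidef k (k' ω) (hk' ω) (hsub ω)
  refine ⟨F, hF0, ?_, hF⟩
  refine ContinuousLinearMap.ext_on (dense_span_kerVectors k) ?_
  rintro _ ⟨y, w, rfl⟩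
  refine eq_of_inner_dense_span (dense_span_kerVectors k) ?_
  rintro _ ⟨x, u, rfl⟩
  rw [← inner_conj_symm _ (kerFun (OfKernel k) x u), ← inner_conj_symm _ (kerFun (OfKernel k) x u)]
  congr 1
  rw [sum_apply, inner_sum]
  simp only [hF]
  rw [← inner_sum, ← sum_apply, ← Matrix.sum_apply, hsum]
  exact (inner_kerFun_kerFun k x y u w).symm

end RadonNikodym

/-! ### Separable Hilbert spaces and extension of isometries. -/

section Separable

/-- Balls of radius `1/2` about orthonormal vectors are disjoint, and a separable space holds only
countably many disjoint nonempty open sets. -/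
lemma countable_of_orthonormal {E : Type*} [NormedAddCommGroup E] [InnerProductSpace ℂ E]
    [TopologicalSpace.SeparableSpace E] {ι : Type*} {b : ι → E} (hb : Orthonormal ℂ b) :
    Countable ι := by
  have hdist : ∀ i j, i ≠ j → 1 ≤ ‖b i - b j‖ := by
    intro i j hij
    have h := norm_sub_sq (𝕜 := ℂ) (b i) (b j)
    rw [hb.2 hij, hb.1 i, hb.1 j] at h
    norm_num at h
    nlinarith [norm_nonneg (b i - b j)]
  have hdisj : Pairwise (Function.onFun Disjoint fun i => Metric.ball (b i) (1 / 2)) := by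
    intro i j hij
    refine Metric.ball_disjoint_ball ?_
    rw [dist_eq_norm]
    have := hdist i j hij
    linarith
  exact hdisj.countable_of_isOpen_disjoint (fun i => Metric.isOpen_ball)
    fun i => Metric.nonempty_ball.2 (by norm_num)

/-- An infinite-dimensional separable Hilbert space has a Hilbert basis indexed by `ℕ`. -/
lemma exists_hilbertBasis_nat {E : Type*} [NormedAddCommGroup E] [InnerProductSpace ℂ E]
    [CompleteSpace E] [TopologicalSpace.SeparableSpace E] {f : ℕ → E} (hf : Orthonormal ℂ f) :
    Nonempty (HilbertBasis ℕ ℂ E) := by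
  obtain ⟨s, b, hb⟩ := exists_hilbertBasis ℂ E
  have hcount : Countable s := countable_of_orthonormal b.orthonormal
  have hinf : Infinite s := by
    by_contra hfin
    rw [not_infinite_iff_finite] at hfin
    have := Fintype.ofFinite s
    have : FiniteDimensional ℂ E := b.toOrthonormalBasis.toBasis.finiteDimensional_of_finite
    exact (not_finite_iff_infinite.2 inferInstance : ¬ Finite ℕ) hf.linearIndependent.finite
  obtain ⟨e⟩ : Nonempty (ℕ ≃ s) := nonempty_equiv_of_countable
  refine ⟨HilbertBasis.mk (v := b ∘ e) (b.orthonormal.comp e e.injective) ?_⟩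
  rw [Set.range_comp, e.surjective.range_eq, Set.image_univ, b.dense_span]

lemma nonempty_linearIsometryEquiv {E F : Type*} [NormedAddCommGroup E] [InnerProductSpace ℂ E]
    [CompleteSpace E] [TopologicalSpace.SeparableSpace E] [NormedAddCommGroup F]
    [InnerProductSpace ℂ F] [CompleteSpace F] [TopologicalSpace.SeparableSpace F]
    {f : ℕ → E} (hf : Orthonormal ℂ f) {g : ℕ → F} (hg : Orthonormal ℂ g) :
    Nonempty (E ≃ₗᵢ[ℂ] F) := by
  obtain ⟨b⟩ := exists_hilbertBasis_nat hf
  obtain ⟨c⟩ := exists_hilbertBasis_nat hg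
  exact ⟨b.repr.trans c.repr.symm⟩

/-- Two isometries into separable Hilbert spaces with infinite-dimensional orthogonal complements
of their ranges are related by a unitary operator. -/
lemma exists_linearIsometryEquiv_extension {H E F : Type*} [NormedAddCommGroup H]
    [InnerProductSpace ℂ H] [CompleteSpace H]
    [NormedAddCommGroup E] [InnerProductSpace ℂ E]
    [CompleteSpace E] [TopologicalSpace.SeparableSpace E] [NormedAddCommGroup F]
    [InnerProductSpace ℂ F] [CompleteSpace F] [TopologicalSpace.SeparableSpace F]
    (a : H →ₗᵢ[ℂ] E) (c : H →ₗᵢ[ℂ] F)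
    {f : ℕ → E} (hf : Orthonormal ℂ f) (hfa : ∀ n x, ⟪a x, f n⟫_ℂ = 0)
    {g : ℕ → F} (hg : Orthonormal ℂ g) (hgc : ∀ n x, ⟪c x, g n⟫_ℂ = 0) :
    ∃ U : E ≃ₗᵢ[ℂ] F, ∀ x, U (a x) = c x := by
  let M := LinearMap.range a.toLinearMap
  let N := LinearMap.range c.toLinearMap
  have hM : IsComplete (M : Set E) := by
    have := a.isometry.isUniformInducing.isComplete_range
    exact this
  have hN : IsComplete (N : Set F) := by
    have := c.isometry.isUniformInducing.isComplete_range
    exact this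
  have : CompleteSpace M := hM.completeSpace_coe
  have : CompleteSpace N := hN.completeSpace_coe
  have hfM : ∀ n, f n ∈ Mᗮ := fun n => by
    rw [Submodule.mem_orthogonal]
    rintro _ ⟨x, rfl⟩
    exact hfa n x
  have hgN : ∀ n, g n ∈ Nᗮ := fun n => by
    rw [Submodule.mem_orthogonal]
    rintro _ ⟨x, rfl⟩
    exact hgc n x
  have hf' : Orthonormal ℂ fun n => (⟨f n, hfM n⟩ : Mᗮ) := hf.codRestrict Mᗮ hfM
  have hg' : Orthonormal ℂ fun n => (⟨g n, hgN n⟩ : Nᗮ) := hg.codRestrict Nᗮ hgN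
  obtain ⟨e₂⟩ := nonempty_linearIsometryEquiv hf' hg'
  let e₁ : M ≃ₗᵢ[ℂ] N := a.equivRange.symm.trans c.equivRange
  -- The unitary is the direct sum of the canonical map between the ranges and any unitary between
  -- their infinite-dimensional complements.
  refine ⟨(M.orthogonalDecomposition.trans (LinearIsometryEquiv.withLpProdCongr 2 e₁ e₂)).trans
    N.orthogonalDecomposition.symm, fun x => ?_⟩
  have hx : (a x : E) ∈ M := ⟨x, rfl⟩
  have hcx : (c x : F) ∈ N := ⟨x, rfl⟩
  have he : e₁ ⟨a x, hx⟩ = ⟨c x, hcx⟩ := by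
    have : (⟨a x, hx⟩ : M) = a.equivRange x := rfl
    rw [this, LinearIsometryEquiv.trans_apply, LinearIsometryEquiv.symm_apply_apply]
    rfl
  rw [LinearIsometryEquiv.trans_apply, LinearIsometryEquiv.symm_apply_eq,
    LinearIsometryEquiv.trans_apply, Submodule.orthogonalDecomposition_apply,
    Submodule.orthogonalDecomposition_apply]
  have h1 : M.orthogonalProjectionOnto (a x) = ⟨a x, hx⟩ :=
    Submodule.orthogonalProjectionOnto_mem_subspace_eq_self (⟨a x, hx⟩ : M)
  have h2 : N.orthogonalProjectionOnto (c x) = ⟨c x, hcx⟩ :=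
    Submodule.orthogonalProjectionOnto_mem_subspace_eq_self (⟨c x, hcx⟩ : N)
  have h3 : Mᗮ.orthogonalProjectionOnto (a x) = 0 :=
    Submodule.orthogonalProjectionOnto_orthogonal_apply_eq_zero hx
  have h4 : Nᗮ.orthogonalProjectionOnto (c x) = 0 :=
    Submodule.orthogonalProjectionOnto_orthogonal_apply_eq_zero hcx
  rw [h1, h2, h3, h4, ← he, ← map_zero e₂]
  rfl

/-- A separable Hilbert space embeds isometrically into the closed span of an orthonormal
sequence. -/
lemma exists_linearIsometry_of_orthonormal {E F : Type*} [NormedAddCommGroup E]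
    [InnerProductSpace ℂ E] [CompleteSpace E] [TopologicalSpace.SeparableSpace E]
    [NormedAddCommGroup F] [InnerProductSpace ℂ F] [CompleteSpace F]
    {f : ℕ → F} (hf : Orthonormal ℂ f) :
    ∃ j : E →ₗᵢ[ℂ] F, ∀ y, (∀ n, ⟪y, f n⟫_ℂ = 0) → ∀ x, ⟪y, j x⟫_ℂ = 0 := by
  obtain ⟨s, b, -⟩ := exists_hilbertBasis ℂ E
  have hcount : Countable s := countable_of_orthonormal b.orthonormal
  obtain ⟨e, he⟩ := exists_injective_nat s
  have ho : Orthonormal ℂ (f ∘ e) := hf.comp e he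
  refine ⟨ho.orthogonalFamily.linearIsometry.comp b.repr.toLinearIsometry, fun y hy x => ?_⟩
  have h := ho.orthogonalFamily.hasSum_linearIsometry (b.repr x)
  have h2 := h.mapL (innerSL ℂ y)
  refine h2.unique (hasSum_zero.congr_fun fun i => ?_)
  simp [hy]

end Separable

/-! ### Vectors of `K ⊗ V` as columns over a basis of `K`. -/

section Columns

open InnerProductSpace (rankOne)

variable {H : Type u₁} {K : Type u₂} {V : Type v}
  [NormedAddCommGroup H] [InnerProductSpace ℂ H]
  [NormedAddCommGroup K] [InnerProductSpace ℂ K]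
  [NormedAddCommGroup V] [InnerProductSpace ℂ V] {ι : Type*}

variable (V) in
/-- The isometry `u ↦ e ⊗ u`, for a unit vector `e`. -/
def htmulLeftₗᵢ (e : K) (he : ‖e‖ = 1) : V →ₗᵢ[ℂ] HTensor K V where
  toLinearMap := (htmulL K V e).toLinearMap
  norm_map' u := by
    change ‖htmul e u‖ = ‖u‖
    rw [norm_htmul, he, one_mul]

@[simp]
lemma htmulLeftₗᵢ_apply (e : K) (he : ‖e‖ = 1) (u : V) : htmulLeftₗᵢ V e he u = htmul e u := rfl

lemma orthonormal_htmul_left {f : ι → V} (hf : Orthonormal ℂ f) {e : K} (he : ‖e‖ = 1) :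
    Orthonormal ℂ fun i => htmul e (f i) :=
  hf.comp_linearIsometry (htmulLeftₗᵢ V e he)

lemma orthogonalFamily_htmul_left {b : ι → K} (hb : Orthonormal ℂ b) :
    OrthogonalFamily ℂ (fun _ => V) fun i => htmulLeftₗᵢ V (b i) (hb.1 i) := fun i j hij u u' => by
  rw [htmulLeftₗᵢ_apply, htmulLeftₗᵢ_apply]
  exact (inner_htmul_htmul (b i) (b j) u u').trans (by rw [hb.2 hij, zero_mul])

lemma inner_htmul_of_hasSum {b : ι → K} (hb : Orthonormal ℂ b) {w : ι → V} {z : HTensor K V}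
    (hz : HasSum (fun i => htmul (b i) (w i)) z) (i : ι) (u : V) :
    ⟪htmul (b i) u, z⟫_ℂ = ⟪u, w i⟫_ℂ := by
  have h1 := hz.mapL (innerSL ℂ (htmul (b i) u))
  have h2 := hasSum_single (f := fun j => ⟪htmul (b i) u, htmul (b j) (w j)⟫_ℂ) i fun j hj => by
    rw [inner_htmul_htmul (b i) (b j) u (w j), hb.2 hj.symm, zero_mul]
  have h3 := h1.unique h2
  rw [inner_htmul_htmul (b i) (b i) u (w i), inner_self_eq_norm_sq_to_K (𝕜 := ℂ) (b i),
    hb.1 i] at h3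
  simpa using h3

lemma opTensor_rankOne_of_hasSum {b : ι → K} (hb : Orthonormal ℂ b) {w : ι → V} {z : HTensor K V}
    (hz : HasSum (fun i => htmul (b i) (w i)) z) (i j : ι) (S : V →L[ℂ] V) :
    opTensor (rankOne ℂ (b i) (b j)) S z = htmul (b i) (S (w j)) := by
  have h1 := hz.mapL (opTensor (rankOne ℂ (b i) (b j)) S)
  have h2 := hasSum_single
    (f := fun l => opTensor (rankOne ℂ (b i) (b j)) S (htmul (b l) (w l))) j fun l hl => by
      rw [opTensor_htmul, InnerProductSpace.rankOne_apply, hb.2 hl.symm, zero_smul]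
      exact map_zero (htmulRight (S (w l)))
  have h3 := h1.unique h2
  rw [opTensor_htmul, InnerProductSpace.rankOne_apply,
    inner_self_eq_norm_sq_to_K (𝕜 := ℂ) (b j), hb.1 j] at h3
  simpa using h3

/-- A sequence `W i` with `∑ i, (W i)† W i = 1` assembles into an isometry
`x ↦ ∑ i, b i ⊗ W i x`. -/
lemma exists_linearIsometry_of_columns [CompleteSpace K] [CompleteSpace V]
    (b : HilbertBasis ι ℂ K) (W : ι → H →L[ℂ] V)
    (hW : ∀ x, HasSum (fun i => ‖W i x‖ ^ 2) (‖x‖ ^ 2)) :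
    ∃ G : H →ₗᵢ[ℂ] HTensor K V, ∀ x, HasSum (fun i => htmul (b i) (W i x)) (G x) := by
  have hs : ∀ x, Summable fun i => htmul (b i) (W i x) := fun x =>
    ((orthogonalFamily_htmul_left (V := V) b.orthonormal).summable_iff_norm_sq_summable
      fun i => W i x).2 (hW x).summable
  let G : H →ₗ[ℂ] HTensor K V :=
    { toFun := fun x => ∑' i, htmul (b i) (W i x)
      map_add' := fun x y => by
        rw [← (hs x).tsum_add (hs y)]
        exact tsum_congr fun i => map_add (htmulL K V (b i) ∘L W i) x y
      map_smul' := fun c x => by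
        rw [RingHom.id_apply, ← (hs x).tsum_const_smul c]
        exact tsum_congr fun i => map_smul (htmulL K V (b i) ∘L W i) c x }
  have hG : ∀ x, HasSum (fun i => htmul (b i) (W i x)) (G x) := fun x => (hs x).hasSum
  refine ⟨⟨G, fun x => ?_⟩, hG⟩
  have h1 := (hG x).mapL (innerSL ℂ (G x))
  have h2 : HasSum (fun i => ((‖W i x‖ ^ 2 : ℝ) : ℂ)) ((‖x‖ ^ 2 : ℝ) : ℂ) :=
    Complex.hasSum_ofReal.2 (hW x)
  have h3 := h1.unique (h2.congr_fun fun i => ?_)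
  · change ⟪G x, G x⟫_ℂ = _ at h3
    rw [inner_self_eq_norm_sq_to_K (𝕜 := ℂ) (G x)] at h3
    exact (pow_left_inj₀ (norm_nonneg _) (norm_nonneg _) two_ne_zero).1
      (Complex.ofReal_injective (by simpa using h3))
  · change ⟪G x, htmul (b i) (W i x)⟫_ℂ = _
    rw [← inner_conj_symm (𝕜 := ℂ), inner_htmul_of_hasSum b.orthonormal (hG x) i (W i x),
      inner_self_eq_norm_sq_to_K (𝕜 := ℂ) (W i x)]
    simp

end Columns

/-! ### Stinespring dilation with the pointer observables on its ancilla. -/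

section Dilation

open InnerProductSpace (rankOne)
open RKHS

/-- A decomposition of the identity extends along an isometry to an observable. -/
lemma exists_observable_of_linearIsometry {L V : Type*} [NormedAddCommGroup L]
    [InnerProductSpace ℂ L] [CompleteSpace L] [NormedAddCommGroup V] [InnerProductSpace ℂ V]
    [CompleteSpace V] (j : L →ₗᵢ[ℂ] V) {Ω : Type w} [Fintype Ω] [Nonempty Ω]
    (F : Ω → L →L[ℂ] L) (hF : ∀ ω, 0 ≤ F ω) (hF1 : ∑ ω, F ω = 1) :
    ∃ F' : Observable Ω V, ∀ ω x y, ⟪j x, F'.toFun ω (j y)⟫_ℂ = ⟪x, F ω y⟫_ℂ := by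
  classical
  obtain ⟨ω₀⟩ := ‹Nonempty Ω›
  let J : L →L[ℂ] V := j.toContinuousLinearMap
  have hJ : ∀ x, J.adjoint (J x) = x := fun x => by
    refine ext_inner_left ℂ fun y => ?_
    exact (ContinuousLinearMap.adjoint_inner_right J y (J x)).trans (j.inner_map_map y x)
  let P : V →L[ℂ] V := J ∘L J.adjoint
  have hP : star (1 - P) * (1 - P) = 1 - P := by
    have h1 : star P = P := by
      rw [ContinuousLinearMap.star_eq_adjoint, ContinuousLinearMap.adjoint_comp,
        ContinuousLinearMap.adjoint_adjoint]
    have h2 : P * P = P := ContinuousLinearMap.ext fun x => congrArg J (hJ (J.adjoint x))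
    rw [star_sub, star_one, h1, sub_mul, mul_sub, mul_sub, h2]
    simp
  have hP0 : 0 ≤ 1 - P := hP ▸ star_mul_self_nonneg (1 - P)
  -- The defect `1 - P` off the range of `j` is assigned to one arbitrary outcome `ω₀`, so that the
  -- total is `1`.
  let F' : Ω → V →L[ℂ] V := fun ω => J ∘L F ω ∘L J.adjoint + if ω = ω₀ then 1 - P else 0
  have h0 : ∀ ω, 0 ≤ F' ω := fun ω => by
    refine add_nonneg ?_ (by split_ifs; exacts [hP0, le_rfl])
    rw [ContinuousLinearMap.nonneg_iff_isPositive]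
    exact ((ContinuousLinearMap.nonneg_iff_isPositive (F ω)).1 (hF ω)).conj_adjoint J
  have h1 : ∑ ω, F' ω = 1 := by
    have h2 : ∑ ω, J ∘L F ω ∘L J.adjoint = P := by
      refine ContinuousLinearMap.ext fun x => ?_
      rw [sum_apply]
      simp only [ContinuousLinearMap.comp_apply]
      rw [← map_sum, ← sum_apply, hF1]
      rfl
    rw [Finset.sum_add_distrib, h2, Finset.sum_ite_eq' Finset.univ ω₀ fun _ => 1 - P,
      if_pos (Finset.mem_univ ω₀), add_sub_cancel]
  refine ⟨⟨F', fun ω => ⟨h0 ω, ?_⟩, h1⟩, fun ω x y => ?_⟩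
  · rw [← h1]
    exact Finset.single_le_sum (fun ω _ => h0 ω) (Finset.mem_univ ω)
  · have h2 : F' ω (J y) = J (F ω y) := by
      have h3 : (1 - P) (J y) = 0 := by
        rw [sub_apply, sub_eq_zero]
        exact (congrArg J (hJ y)).symm
      change J (F ω (J.adjoint (J y))) + (if ω = ω₀ then 1 - P else 0 : V →L[ℂ] V) (J y) = _
      rw [hJ]
      split_ifs
      · rw [h3, add_zero]
      · rw [zero_apply, add_zero]
    exact (congrArg (fun z => ⟪j x, z⟫_ℂ) h2).trans (j.inner_map_map x (F ω y))

variable {H : Type u₁} {K : Type u₂} {V : Type v}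
  [NormedAddCommGroup H] [InnerProductSpace ℂ H] [CompleteSpace H]
  [NormedAddCommGroup K] [InnerProductSpace ℂ K] [CompleteSpace K]
  [NormedAddCommGroup V] [InnerProductSpace ℂ V] [CompleteSpace V]

/-- This exhibits the matrix units as a Gram family, so that the Choi kernel of an operation is an
instance of `opKernel`. -/
lemma star_rankOne_mul_rankOne {e : K} (he : ‖e‖ = 1) (x y : K) :
    star (rankOne ℂ e x) * rankOne ℂ e y = rankOne ℂ x y := by
  refine ContinuousLinearMap.ext fun z => ?_
  rw [ContinuousLinearMap.star_eq_adjoint, InnerProductSpace.adjoint_rankOne, mul_apply_eq_comp]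
  simp only [InnerProductSpace.rankOne_apply, inner_smul_right]
  rw [inner_self_eq_norm_sq_to_K (𝕜 := ℂ) e, he]
  simp

/-- A channel has an isometric dilation such that every instrument with this total channel is
obtained from an observable on the dilation space. -/
lemma exists_dilation [TopologicalSpace.SeparableSpace H] [TopologicalSpace.SeparableSpace K]
    [Nontrivial H] {Λ : (K →L[ℂ] K) →ₗ[ℂ] (H →L[ℂ] H)} (hΛ : IsChannel Λ) {e : K} (he : ‖e‖ = 1)
    {f : ℕ → V} (hf : Orthonormal ℂ f) :
    ∃ G : H →ₗᵢ[ℂ] HTensor K V, (∀ n x, ⟪G x, htmul e (f (2 * n + 1))⟫_ℂ = 0) ∧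
      ∀ (Ω : Type w) [Fintype Ω] (I : Instrument H K Ω), I.onSet Finset.univ = Λ →
        ∃ F : Observable Ω V, ∀ ω T x y,
          ⟪G x, opTensor T (F.toFun ω) (G y)⟫_ℂ = ⟪x, I.toFun ω T y⟫_ℂ := by
  obtain ⟨s, b, -⟩ := exists_hilbertBasis ℂ K
  have : Countable s := countable_of_orthonormal b.orthonormal
  let A : s → K →L[ℂ] K := fun i => rankOne ℂ e (b i)
  have hA : ∀ i j, star (A i) * A j = rankOne ℂ (b i) (b j) :=
    fun i j => star_rankOne_mul_rankOne he (b i) (b j)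
  let k := opKernel Λ A
  have : Fact k.PosSemidef := ⟨hΛ.1.posSemidef_opKernel A⟩
  have : TopologicalSpace.SeparableSpace (OfKernel k) := separableSpace_ofKernel k
  -- The kernel space is placed in the span of the even vectors; the odd ones stay orthogonal and
  -- leave room for the unitary extension.
  have hf2 : Orthonormal ℂ fun n => f (2 * n) :=
    hf.comp (fun n => 2 * n) fun m n h => by simpa using h
  obtain ⟨j, hj⟩ := exists_linearIsometry_of_orthonormal (E := OfKernel k) hf2
  let W : s → H →L[ℂ] V := fun i => j.toContinuousLinearMap ∘L kerFun (OfKernel k) i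
  -- The partial sums are `⟪x, Λ (P_t) x⟫`; normality and `Λ 1 = 1` give the limit `‖x‖²`.
  have hW : ∀ x, HasSum (fun i => ‖W i x‖ ^ 2) (‖x‖ ^ 2) := by
    intro x
    have h1 := (Complex.continuous_re.tendsto _).comp (hΛ.1.tendsto_inner_map_basisProj b x x)
    rw [hΛ.2, one_apply_eq_self] at h1
    have h2 : (⟪x, x⟫_ℂ).re = ‖x‖ ^ 2 := (norm_sq_eq_re_inner (𝕜 := ℂ) x).symm
    rw [h2] at h1
    refine h1.congr fun t => ?_
    rw [Function.comp_apply, basisProj, map_sum, sum_apply, inner_sum, Complex.re_sum]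
    refine Finset.sum_congr rfl fun i _ => ?_
    have h3 : ‖W i x‖ = ‖kerFun (OfKernel k) i x‖ := j.norm_map _
    simp only [h3]
    rw [norm_sq_eq_re_inner (𝕜 := ℂ) (kerFun (OfKernel k) i x), ← hA]
    exact congrArg Complex.re (inner_kerFun_kerFun k i i x x).symm
  obtain ⟨G, hG⟩ := exists_linearIsometry_of_columns b W hW
  refine ⟨G, fun n x => ?_, fun Ω _ I hI => ?_⟩
  · have h0 : ∀ i, ⟪f (2 * n + 1), W i x⟫_ℂ = 0 := fun i =>
      hj (f (2 * n + 1)) (fun m => hf.2 (by omega)) (kerFun (OfKernel k) i x)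
    have h1 := (hG x).mapL (innerSL ℂ (htmul e (f (2 * n + 1))))
    have h2 := h1.unique (hasSum_zero.congr_fun fun i =>
      (inner_htmul_htmul e (b i) (f (2 * n + 1)) (W i x)).trans (by rw [h0, mul_zero]))
    exact inner_eq_zero_symm.1 h2
  · have : Nonempty Ω := by
      by_contra hne
      rw [not_nonempty_iff] at hne
      have h0 : Λ 1 = 0 := by rw [← hI, Instrument.onSet]; simp
      rw [hΛ.2] at h0
      exact one_ne_zero h0
    obtain ⟨F₀, hF₀, hF₁, hF₂⟩ := exists_decomposition_of_sum_eq k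
      (fun ω => opKernel (I.toFun ω) A) (fun ω => (I.isOperation ω).posSemidef_opKernel A) (by
        ext1 i l
        rw [Matrix.sum_apply]
        simp only [opKernel_apply, k]
        rw [← hI, Instrument.onSet, LinearMap.sum_apply])
    obtain ⟨F, hF⟩ := exists_observable_of_linearIsometry j F₀ hF₀ hF₁
    -- The observable `F` defines an instrument `I'` through `G`. Its members are operations, so
    -- agreement with `I` can be checked on matrix units alone.
    obtain ⟨I', hI'⟩ := exists_instrument_of_hasSum (κ := Unit)
      (G := fun _ => (G.toContinuousLinearMap : H →L[ℂ] HTensor K V)) (hasSum_fintype _).summable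
      (fun x y => G.inner_map_map x y ▸ hasSum_unique fun _ : Unit => ⟪G x, G y⟫_ℂ) F
    have hI'' : ∀ ω T x y, ⟪G x, opTensor T (F.toFun ω) (G y)⟫_ℂ = ⟪x, I'.toFun ω T y⟫_ℂ :=
      fun ω T x y => (hasSum_unique fun _ : Unit =>
        ⟪G x, opTensor T (F.toFun ω) (G y)⟫_ℂ).unique (hI' ω T x y)
    refine ⟨F, fun ω T x y => ?_⟩
    have hext : I'.toFun ω = I.toFun ω := by
      refine (I'.isOperation ω).ext_rankOne b (I.isOperation ω) fun i l => ?_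
      refine ContinuousLinearMap.ext fun y => ext_inner_left ℂ fun x => ?_
      rw [← hI'' ω, opTensor_rankOne_of_hasSum b.orthonormal (hG y) i l,
        ← inner_conj_symm (𝕜 := ℂ), inner_htmul_of_hasSum b.orthonormal (hG x) i,
        inner_conj_symm (𝕜 := ℂ)]
      refine (hF ω _ _).trans ((hF₂ ω i l x y).trans ?_)
      rw [opKernel_apply, hA]
    rw [hI'', hext]

end Dilation

/-! ### Construction of the coupling. -/

section Realization

open InnerProductSpace (rankOne)

/-- There are infinite-dimensional separable Hilbert spaces in every universe. -/
lemma exists_orthonormal_nat_separable : ∃ (V : Type v) (_ : NormedAddCommGroup V)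
    (_ : InnerProductSpace ℂ V) (_ : CompleteSpace V), TopologicalSpace.SeparableSpace V ∧
      ∃ f : ℕ → V, Orthonormal ℂ f := by
  let b : HilbertBasis (ULift.{v} ℕ) ℂ (lp (fun _ : ULift.{v} ℕ => ℂ) 2) := default
  have hs : TopologicalSpace.SeparableSpace (lp (fun _ : ULift.{v} ℕ => ℂ) 2) := by
    have := ((Set.countable_range b).isSeparable.span (R := ℂ)).closure
    rw [← Submodule.topologicalClosure_coe, b.dense_span, Submodule.top_coe] at this
    exact TopologicalSpace.isSeparable_univ_iff.1 this
  exact ⟨_, _, _, inferInstance, hs, _, b.orthonormal.comp ULift.up ULift.up_injective⟩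

lemma exists_subsingleton_hilbertSpace : ∃ (V : Type v) (_ : NormedAddCommGroup V)
    (_ : InnerProductSpace ℂ V) (_ : CompleteSpace V), Subsingleton V :=
  ⟨lp (fun _ : PEmpty.{v + 1} => ℂ) 2, inferInstance, inferInstance, inferInstance,
    ⟨fun _ _ => lp.ext (funext fun i => i.elim)⟩⟩

/-- The pure state given by a unit vector. -/
def State.pure {V : Type v} [NormedAddCommGroup V] [InnerProductSpace ℂ V] [CompleteSpace V]
    (ξ : V) (hξ : ‖ξ‖ = 1) : State V where
  op := rankOne ℂ ξ ξ
  nonneg := by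
    rw [ContinuousLinearMap.nonneg_iff_isPositive]
    exact InnerProductSpace.isPositive_rankOne_self ξ
  trace_eq_one ι b := by
    have h := b.hasSum_inner_mul_inner ξ ξ
    rw [inner_self_eq_norm_sq_to_K (𝕜 := ℂ) ξ, hξ] at h
    refine HasSum.congr_fun (by simpa using h) fun i => ?_
    rw [InnerProductSpace.rankOne_apply, inner_smul_right]

variable {H : Type u₁} {K : Type u₂}
  [NormedAddCommGroup H] [InnerProductSpace ℂ H] [CompleteSpace H]
  [NormedAddCommGroup K] [InnerProductSpace ℂ K] [CompleteSpace K]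

lemma subsingleton_hTensor {H : Type u₁} {V : Type u₂} [NormedAddCommGroup H]
    [InnerProductSpace ℂ H] [NormedAddCommGroup V] [InnerProductSpace ℂ V]
    (h : Subsingleton H ∨ Subsingleton V) : Subsingleton (HTensor H V) := by
  refine ⟨fun x y => hTensor_ext_inner fun a b => ?_⟩
  have : htmul a b = 0 := by
    rw [← norm_eq_zero, norm_htmul]
    rcases h with h | h
    · rw [Subsingleton.elim a 0, norm_zero, zero_mul]
    · rw [Subsingleton.elim b 0, norm_zero, mul_zero]
  rw [this, inner_zero_right, inner_zero_right]

/-- With `H = 0` the space `K ⊗ V₂` must vanish although `K` need not, so take `V₂ = 0`; `V₁` must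
stay nonzero to carry a state. -/
lemma exists_coupling_of_subsingleton [Subsingleton H] (Λ : (K →L[ℂ] K) →ₗ[ℂ] (H →L[ℂ] H)) :
    ∃ C : Coupling.{u₁, u₂, v} H K, TopologicalSpace.SeparableSpace C.V₁ ∧
      TopologicalSpace.SeparableSpace C.V₂ ∧
      ∀ (Ω : Type w) [Fintype Ω] (I : Instrument H K Ω), I.onSet Finset.univ = Λ →
        ∃ F : Observable Ω C.V₂, ∀ X T,
          IsPartialTrace (C.evolve T (F.onSet X)) (I.onSet X T) := by
  obtain ⟨V, _, _, _, _, f, hf⟩ := exists_orthonormal_nat_separable.{v}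
  obtain ⟨V₂, _, _, _, hV₂⟩ := exists_subsingleton_hilbertSpace.{v}
  have h1 : Subsingleton (HTensor H V) := subsingleton_hTensor (Or.inl inferInstance)
  have h2 : Subsingleton (HTensor K V₂) := subsingleton_hTensor (Or.inr hV₂)
  let U : HTensor H V ≃ₗᵢ[ℂ] HTensor K V₂ :=
    { toLinearEquiv := LinearEquiv.ofSubsingleton _ _
      norm_map' := fun x => by rw [Subsingleton.elim x 0, map_zero, norm_zero, norm_zero] }
  have h3 : Subsingleton (V₂ →L[ℂ] V₂) := ⟨fun A B => ContinuousLinearMap.ext fun x => hV₂.elim _ _⟩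
  refine ⟨⟨V, V₂, State.pure (f 0) (hf.1 0), U⟩, ‹_›, (inferInstance :
    TopologicalSpace.SeparableSpace V₂), fun Ω _ I _ => ⟨⟨fun _ => 0, fun _ => ⟨le_rfl,
      (Subsingleton.elim (0 : V₂ →L[ℂ] V₂) 1).le⟩, h3.elim _ _⟩, fun X T ι b x y => ?_⟩⟩
  rw [Subsingleton.elim x 0, inner_zero_left]
  refine hasSum_zero.congr_fun fun i => ?_
  have h4 : htmul (0 : H) (b i) = 0 := h1.elim _ _
  rw [h4, inner_zero_left]

/-- All instruments with a given total channel are realized by one coupling with varying pointer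
observables. -/
theorem IsChannel.exists_coupling [TopologicalSpace.SeparableSpace H]
    [TopologicalSpace.SeparableSpace K] {Λ : (K →L[ℂ] K) →ₗ[ℂ] (H →L[ℂ] H)} (hΛ : IsChannel Λ) :
    ∃ C : Coupling.{u₁, u₂, v} H K, TopologicalSpace.SeparableSpace C.V₁ ∧
      TopologicalSpace.SeparableSpace C.V₂ ∧
      ∀ (Ω : Type w) [Fintype Ω] (I : Instrument H K Ω), I.onSet Finset.univ = Λ →
        ∃ F : Observable Ω C.V₂, ∀ X T,
          IsPartialTrace (C.evolve T (F.onSet X)) (I.onSet X T) := by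
  obtain ⟨V, _, _, _, _, f, hf⟩ := exists_orthonormal_nat_separable.{v}
  rcases subsingleton_or_nontrivial H with hH | hH
  · exact exists_coupling_of_subsingleton Λ
  -- If `K` were zero, then `1 = 0` on `K` and `Λ 1 = 1` would contradict the nontriviality of `H`.
  · obtain ⟨e, he⟩ : ∃ e : K, ‖e‖ = 1 := by
      rcases subsingleton_or_nontrivial K with hK | hK
      · have h0 : (1 : K →L[ℂ] K) = 0 := ContinuousLinearMap.ext fun x => Subsingleton.elim _ _
        have h1 := hΛ.2
        rw [h0, map_zero] at h1
        exact absurd h1.symm one_ne_zero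
      · exact exists_norm_eq K zero_le_one
    obtain ⟨h, hh⟩ : ∃ h : H, ‖h‖ = 1 := exists_norm_eq H zero_le_one
    obtain ⟨G, hG, hI⟩ := exists_dilation.{u₁, u₂, v, w} hΛ he hf
    let a : H →ₗᵢ[ℂ] HTensor H V :=
      { toLinearMap := (htmulRight (f 0)).toLinearMap
        norm_map' := fun x => by
          change ‖htmul x (f 0)‖ = ‖x‖
          rw [norm_htmul, hf.1 0, mul_one] }
    have : TopologicalSpace.SeparableSpace (HTensor H V) := separableSpace_hTensor
    have : TopologicalSpace.SeparableSpace (HTensor K V) := separableSpace_hTensor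
    -- The orthogonal sequences are `h ⊗ f (n + 1)`, which avoids `f 0`, and `e ⊗ f (2 n + 1)`, left
    -- free by the dilation.
    obtain ⟨U, hU⟩ := exists_linearIsometryEquiv_extension a G
      (orthonormal_htmul_left (hf.comp Nat.succ Nat.succ_injective) hh)
      (fun n x => (inner_htmul_htmul x h (f 0) (f (n + 1))).trans (by
        rw [hf.2 n.succ_ne_zero.symm, mul_zero]))
      (orthonormal_htmul_left (hf.comp (fun n => 2 * n + 1) fun m n h => by simpa using h) he) hG
    have hU' : ∀ x, U (htmul x (f 0)) = G x := hU
    let C : Coupling.{u₁, u₂, v} H K := ⟨V, V, State.pure (f 0) (hf.1 0), U⟩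
    refine ⟨C, ‹_›, ‹_›, fun Ω _ I hIΛ => ?_⟩
    obtain ⟨F, hF⟩ := hI Ω I hIΛ
    refine ⟨F, fun X T => ?_⟩
    rw [Observable.onSet, Instrument.onSet, C.evolve_sum, LinearMap.sum_apply]
    refine IsPartialTrace.sum fun ω _ => ?_
    -- The state is pure, so a single Kraus operator `U (· ⊗ f 0) = G` suffices.
    refine isPartialTrace_of_hasSum (κ := Unit) (g := fun _ => f 0) (hasSum_fintype _).summable
      (fun x y => ?_) fun x y => ?_
    · have h1 : ⟪x, C.η.op y⟫_ℂ = ⟪x, f 0⟫_ℂ * ⟪f 0, y⟫_ℂ := by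
        change ⟪x, rankOne ℂ (f 0) (f 0) y⟫_ℂ = _
        rw [InnerProductSpace.rankOne_apply, inner_smul_right, mul_comm]
      exact h1 ▸ hasSum_unique fun _ : Unit => ⟪x, f 0⟫_ℂ * ⟪f 0, y⟫_ℂ
    · rw [← hF ω T x y, ← hU' x, ← hU' y]
      have h1 := ContinuousLinearMap.adjoint_inner_right
        (U.toContinuousLinearEquiv : HTensor H V →L[ℂ] HTensor K V) (htmul x (f 0))
        (opTensor T (F.toFun ω) (U (htmul y (f 0))))
      exact h1 ▸ hasSum_unique fun _ : Unit => _

end Realization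

end

end QDevice

/-! ### The proposition. -/

theorem mainTheorem1 {H : Type u₁} {K : Type u₂}
    [NormedAddCommGroup H] [InnerProductSpace ℂ H] [CompleteSpace H]
    [TopologicalSpace.SeparableSpace H]
    [NormedAddCommGroup K] [InnerProductSpace ℂ K] [CompleteSpace K]
    [TopologicalSpace.SeparableSpace K]
    (D₁ D₂ : QDevice.Device.{u₁, u₂, w} H K) :
    ((QDevice.Compatible D₁ D₂ ↔
        ∃ M : QDevice.MeasurementModel.{u₁, u₂, v, w} H K,
          D₁.IsPartOfModel M ∧ D₂.IsPartOfModel M) ∧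
      (QDevice.Compatible D₁ D₂ →
        ∃ M : QDevice.MeasurementModel.{u₁, u₂, v, w} H K, M.IsSeparable ∧
          D₁.IsPartOfModel M ∧ D₂.IsPartOfModel M)) ∧
    ((QDevice.WeaklyCompatible D₁ D₂ ↔
        ∃ M₁ M₂ : QDevice.MeasurementModel.{u₁, u₂, v, w} H K, M₁.DifferOnlyInPointer M₂ ∧
          D₁.IsPartOfModel M₁ ∧ D₂.IsPartOfModel M₂) ∧
      (QDevice.WeaklyCompatible D₁ D₂ →
        ∃ M₁ M₂ : QDevice.MeasurementModel.{u₁, u₂, v, w} H K, M₁.DifferOnlyInPointer M₂ ∧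
          M₁.IsSeparable ∧ M₂.IsSeparable ∧
          D₁.IsPartOfModel M₁ ∧ D₂.IsPartOfModel M₂)) := by
  have ha : QDevice.Compatible D₁ D₂ →
      ∃ M : QDevice.MeasurementModel.{u₁, u₂, v, w} H K, M.IsSeparable ∧
        D₁.IsPartOfModel M ∧ D₂.IsPartOfModel M := by
    rintro ⟨Ω, _, I, h₁, h₂⟩
    obtain ⟨C, hV₁, hV₂, hC⟩ := QDevice.IsChannel.exists_coupling.{u₁, u₂, v, w} I.isChannel
    obtain ⟨F, hF⟩ := hC Ω I rfl
    let M : QDevice.MeasurementModel.{u₁, u₂, v, w} H K := ⟨C, Ω, F⟩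
    exact ⟨M, ⟨hV₁, hV₂⟩, (D₁.isPartOfModel_iff M I hF).2 h₁, (D₂.isPartOfModel_iff M I hF).2 h₂⟩
  have hb : QDevice.WeaklyCompatible D₁ D₂ →
      ∃ M₁ M₂ : QDevice.MeasurementModel.{u₁, u₂, v, w} H K, M₁.DifferOnlyInPointer M₂ ∧
        M₁.IsSeparable ∧ M₂.IsSeparable ∧ D₁.IsPartOfModel M₁ ∧ D₂.IsPartOfModel M₂ := by
    rintro ⟨Ω₁, Ω₂, _, _, I₁, I₂, h₁, h₂, hI⟩
    obtain ⟨C, hV₁, hV₂, hC⟩ := QDevice.IsChannel.exists_coupling.{u₁, u₂, v, w} I₁.isChannel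
    obtain ⟨F₁, hF₁⟩ := hC Ω₁ I₁ rfl
    -- The coupling depends only on the common total channel, so it also realizes `I₂`, with another
    -- pointer.
    obtain ⟨F₂, hF₂⟩ := hC Ω₂ I₂ hI.symm
    let M₁ : QDevice.MeasurementModel.{u₁, u₂, v, w} H K := ⟨C, Ω₁, F₁⟩
    let M₂ : QDevice.MeasurementModel.{u₁, u₂, v, w} H K := ⟨C, Ω₂, F₂⟩
    exact ⟨M₁, M₂, rfl, ⟨hV₁, hV₂⟩, ⟨hV₁, hV₂⟩, (D₁.isPartOfModel_iff M₁ I₁ hF₁).2 h₁,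
      (D₂.isPartOfModel_iff M₂ I₂ hF₂).2 h₂⟩
  refine ⟨⟨⟨fun h => ?_, ?_⟩, ha⟩, ⟨fun h => ?_, ?_⟩, hb⟩
  · obtain ⟨M, -, hM⟩ := ha h
    exact ⟨M, hM⟩
  · rintro ⟨M, h₁, h₂⟩
    exact QDevice.compatible_of_isPartOfModel h₁ h₂
  · obtain ⟨M₁, M₂, hM, -, -, h₁₂⟩ := hb h
    exact ⟨M₁, M₂, hM, h₁₂⟩
  · rintro ⟨M₁, M₂, hM, h₁, h₂⟩
    exact QDevice.weaklyCompatible_of_isPartOfModel hM h₁ h₂
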